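/- A permutation of size $n=|\sigma|$ is a bijection $\sigma$ of $\{1,\dots,n\}$, written as the word $\sigma_1\sigma_2\cdots\sigma_n$ with $\sigma_i=\sigma(i)$. Write $\pi\preceq\sigma$ ($\pi$ is a pattern of $\sigma$) if there are indices $i_1<\dots<i_{|\pi|}$ such that the word $\pi$ is order-isomorphic to $\sigma_{i_1}\cdots\sigma_{i_{|\pi|}}$. An interval of $\sigma$ is a nonempty block $\sigma_i\sigma_{i+1}\cdots\sigma_j$ of consecutive entries whose set of values is a set of consecutive integers; $\sigma$ is simple if its only intervals are the singletons and the whole permutation. A permutation is exceptional if, for some $m\ge 2$, it is one of $$2\,4\,6\cdots(2m)\;1\,3\,5\cdots(2m-1),\qquad (2m-1)\,(2m-3)\cdots 1\;(2m)\,(2m-2)\cdots 2,$$ $$(m+1)\,1\,(m+2)\,2\cdots(2m)\,m,\qquad m\,(2m)\,(m-1)\,(2m-1)\cdots 1\,(m+1).$$ **Theorem.** Let $\pi\neq\sigma$ be simple permutations with $\pi\preceq\sigma$ and $|\pi|\ge 3$. Then there exist a natural number $k$, a chain of simple permutations $\sigma^{(0)}=\sigma,\sigma^{(1)},\dots,\sigma^{(k)}=\pi$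 and $m\in\{0,\dots,k\}$ such that $\sigma^{(i)}\preceq\sigma^{(i-1)}$ for $1\le i\le k$, and - $|\sigma^{(i-1)}|-|\sigma^{(i)}|=1$ for $1\le i\le m$; - $|\sigma^{(i-1)}|-|\sigma^{(i)}|=2$ for $m+1\le i\le k$; - if $m<k$, then $\sigma^{(i)}$ is exceptional for every $i$ with $m\le i\le k$. -/

import Mathlib

/-- A permutation of size `n`, for some `n`: a bijection of `{1, …, n}`, with `{1, …, n}` modelled
by `Fin n = {0, …, n - 1}`. -/
abbrev Permutation : Type := Σ n : ℕ, Equiv.Perm (Fin n)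

namespace Permutation

/-- The size `|σ|`. -/
abbrev size (σ : Permutation) : ℕ := σ.1

/-- `π ≼ σ`: some subsequence of the word of `σ`, at positions `f 0 < f 1 < …`, is
order-isomorphic to the word of `π`. -/
def IsPattern (π σ : Permutation) : Prop :=
  ∃ f : Fin π.size → Fin σ.size, StrictMono f ∧
    ∀ i j : Fin π.size, π.2 i < π.2 j ↔ σ.2 (f i) < σ.2 (f j)

/-- The nonempty block of positions `i, i + 1, …, j` is an interval of `σ`: its values form an
interval. -/
def IsInterval (σ : Permutation) (i j : Fin σ.size) : Prop :=
  i ≤ j ∧ ∃ a b : Fin σ.size, σ.2 '' Set.Icc i j = Set.Icc a b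

/-- `σ` is simple: its intervals are the singletons and the whole permutation. -/
def IsSimple (σ : Permutation) : Prop :=
  ∀ i j : Fin σ.size, σ.IsInterval i j → i = j ∨ Set.Icc i j = Set.univ

/-- In the usual numbering from 1, the entry of `σ` at position `p` is `v`, that is `σ_p = v`. -/
def HasEntry (σ : Permutation) (p v : ℕ) : Prop :=
  ∃ k : Fin σ.size, (k : ℕ) + 1 = p ∧ (σ.2 k : ℕ) + 1 = v

/-- `2 4 6 … (2m) 1 3 5 … (2m-1)`. -/
def IsType1 (m : ℕ) (σ : Permutation) : Prop :=
  σ.size = 2 * m ∧ ∀ i : ℕ, 1 ≤ i → i ≤ m →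
    σ.HasEntry i (2 * i) ∧ σ.HasEntry (m + i) (2 * i - 1)

/-- `(2m-1) (2m-3) … 1 (2m) (2m-2) … 2`. -/
def IsType2 (m : ℕ) (σ : Permutation) : Prop :=
  σ.size = 2 * m ∧ ∀ i : ℕ, 1 ≤ i → i ≤ m →
    σ.HasEntry i (2 * m + 1 - 2 * i) ∧ σ.HasEntry (m + i) (2 * m + 2 - 2 * i)

/-- `(m+1) 1 (m+2) 2 … (2m) m`. -/
def IsType3 (m : ℕ) (σ : Permutation) : Prop :=
  σ.size = 2 * m ∧ ∀ i : ℕ, 1 ≤ i → i ≤ m →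
    σ.HasEntry (2 * i - 1) (m + i) ∧ σ.HasEntry (2 * i) i

/-- `m (2m) (m-1) (2m-1) … 1 (m+1)`. -/
def IsType4 (m : ℕ) (σ : Permutation) : Prop :=
  σ.size = 2 * m ∧ ∀ i : ℕ, 1 ≤ i → i ≤ m →
    σ.HasEntry (2 * i - 1) (m + 1 - i) ∧ σ.HasEntry (2 * i) (2 * m + 1 - i)

/-- Exceptional permutations. -/
def IsExceptional (σ : Permutation) : Prop :=
  ∃ m : ℕ, 2 ≤ m ∧ (IsType1 m σ ∨ IsType2 m σ ∨ IsType3 m σ ∨ IsType4 m σ)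

end Permutation

/-! A permutation is a pair of linear orders on its entries. Colour each ordered pair of entries by
how the two compare in position and in value (`code`). The nonempty modules of this colouring are
exactly the intervals, so simple means prime (`isSimple_iff`), and patterns are the substructures on
subsets of entries.

For reversible colourings there is an Ehrenfeucht–Rozenberg type theorem: inside a prime structure,
a proper prime subset with at least three points can be enlarged by one or two points and stay prime
(`IsPrimeSet.exists_pair`). A maximal proper prime set above an occurrence of `π` therefore misses
one or two entries of `σ` (`IsPrimeSet.exists_large`), which gives a simple permutation `τ` between
`π` and `σ` of size one or two less.

Suppose no one-point deletion works, and `τ` arises by deleting `x` and `y`. Putting `y` back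
destroys primality, so `y` is either a corner over the remaining entries or a twin of some `z`; in
the second case `x` and `z` can be deleted instead, with the same result `τ`. Both `x` and `y`
cannot be corners, so an exchange exists. By simplicity of `σ`, `x` separates the twins in exactly
one of the two orders. If this is the order by position, repeated exchanges sweep along the whole
word (`IsPairDeletion.step`, `IsPairDeletion.propagate`): entries at distance two have consecutive
values, and the ends are corners. This zigzag shape forces types 3 and 4 (`IsZigzag.type3_or_type4`)
and passes to `τ`; the order by value gives types 1 and 2 through inverses.

Finally, an exceptional permutation has no simple one-point deletion. In a chain built step by step,
a step of size two is thus never followed by a step of size one. -/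

namespace Permutation

/-! ### Prime sets of edge colourings and their extension by one or two points. -/

section Prime

variable {α κ : Type*}

/-- `M` is a module of `S` for the edge colouring `c`: the points of `S` outside `M` do not
distinguish the points of `M`. -/
def IsModuleOf (c : α → α → κ) (S M : Set α) : Prop :=
  M ⊆ S ∧ ∀ v ∈ S, v ∉ M → ∀ x ∈ M, ∀ y ∈ M, c v x = c v y

/-- `S` is prime for the edge colouring `c`: all its modules are trivial. -/
def IsPrimeSet (c : α → α → κ) (S : Set α) : Prop :=
  ∀ M, IsModuleOf c S M → M.Subsingleton ∨ M = S

/-- The colour of a pair determines the colour of the reversed pair. -/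
def IsReversible (c : α → α → κ) : Prop :=
  ∀ a b d e, a ≠ b → d ≠ e → c a b = c d e → c b a = c e d

variable {c : α → α → κ} {X : Set α}

theorem IsModuleOf.inter {S T M : Set α} (h : IsModuleOf c S M) (hT : T ⊆ S) :
    IsModuleOf c T (M ∩ T) :=
  ⟨Set.inter_subset_right, fun v hv hvM x hx y hy =>
    h.2 v (hT hv) (fun hm => hvM ⟨hm, hv⟩) x hx.1 y hy.1⟩

theorem exists_nontrivial_module {S : Set α} (h : ¬ IsPrimeSet c S) :
    ∃ M, IsModuleOf c S M ∧ M.Nontrivial ∧ M ≠ S := by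
  unfold IsPrimeSet at h
  push Not at h
  obtain ⟨M, h1, h2, h3⟩ := h
  exact ⟨M, h1, h2, h3⟩

/-- No point of a prime set sees all the other points in the same way. -/
theorem IsPrimeSet.not_uniform (hX : IsPrimeSet c X) (h3 : ∀ u v, ∃ w ∈ X, w ≠ u ∧ w ≠ v) {u : α}
    (hu : u ∈ X) (h : ∀ a ∈ X, ∀ b ∈ X, a ≠ u → b ≠ u → c u a = c u b) : False := by
  obtain ⟨a, ha, hau, -⟩ := h3 u u
  obtain ⟨b, hb, hbu, hba⟩ := h3 u a
  rcases hX (X \ {u}) ⟨Set.sdiff_subset, fun v hv hvM x hx y hy => by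
    have : v = u := by by_contra hne; exact hvM ⟨hv, hne⟩
    subst this
    exact h x hx.1 y hy.1 hx.2 hy.2⟩ with h | h
  · exact hba (h ⟨hb, hbu⟩ ⟨ha, hau⟩)
  · rw [← h] at hu
    exact hu.2 rfl

/-- A prime set has no pair of twins. -/
theorem IsPrimeSet.not_twins (hX : IsPrimeSet c X) (h3 : ∀ u v, ∃ w ∈ X, w ≠ u ∧ w ≠ v) {u v : α}
    (hu : u ∈ X) (hv : v ∈ X) (huv : u ≠ v)
    (h : ∀ w ∈ X, w ≠ u → w ≠ v → c w u = c w v) : False := by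
  obtain ⟨a, ha, hau, hav⟩ := h3 u v
  rcases hX {u, v} ⟨by rintro x (rfl | rfl) <;> assumption, fun w hw hwM x hx y hy => by
    simp only [Set.mem_insert_iff, Set.mem_singleton_iff, not_or] at hwM hx hy
    have := h w hw hwM.1 hwM.2
    rcases hx with rfl | rfl <;> rcases hy with rfl | rfl <;> simp [this]⟩ with h | h
  · exact huv (h (by simp) (by simp))
  · rw [← h] at ha
    simp [hau, hav] at ha

/-- `x` sees all the points of `X` in the same way. -/
def IsOuter (c : α → α → κ) (X : Set α) (x : α) : Prop :=
  ∀ a ∈ X, ∀ b ∈ X, c x a = c x b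

/-- No other point of `X` distinguishes `u` and `x`. -/
def IsTwin (c : α → α → κ) (X : Set α) (u x : α) : Prop :=
  u ∈ X ∧ ∀ w ∈ X, w ≠ u → c w u = c w x

/-- A nontrivial module of the enlarged set meets `X` in a trivial module: either in at most one
point `u`, and then it is `{u, x}`, or in all of `X`, and then it is `X` itself. -/
theorem IsPrimeSet.outer_or_twin (hX : IsPrimeSet c X) {x : α}
    (h : ¬ IsPrimeSet c (insert x X)) : IsOuter c X x ∨ ∃ u, IsTwin c X u x := by
  obtain ⟨M, hM, hnt, hne⟩ := exists_nontrivial_module h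
  rcases hX _ (hM.inter (Set.subset_insert x X)) with h1 | h1
  · right
    obtain ⟨a, ha, b, hb, hab⟩ := hnt
    have key : ∀ a ∈ M, ∀ b ∈ M, a ≠ b → b ∉ X → IsTwin c X a x := by
      intro a ha b hb hab hbX
      have hbx : b = x := (hM.1 hb).resolve_right hbX
      subst hbx
      have haX : a ∈ X := (hM.1 ha).resolve_left hab
      refine ⟨haX, fun w hw hwa => hM.2 w (Or.inr hw) (fun hwM => hwa ?_) a ha b hb⟩
      exact h1 ⟨hwM, hw⟩ ⟨ha, haX⟩
    by_cases hbX : b ∈ X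
    · by_cases haX : a ∈ X
      · exact absurd (h1 ⟨ha, haX⟩ ⟨hb, hbX⟩) hab
      · exact ⟨b, key b hb a ha hab.symm haX⟩
    · exact ⟨a, key a ha b hb hab hbX⟩
  · left
    have hXM : X ⊆ M := Set.inter_eq_right.mp h1
    have hxM : x ∉ M := fun hx => hne (hM.1.antisymm (Set.insert_subset hx hXM))
    exact fun a ha b hb => hM.2 x (Or.inl rfl) hxM a (hXM ha) b (hXM hb)

/-- The trace on `X` of a nontrivial module is trivial. The only traces compatible with primality of
`X` and with `y` not being outer come from the modules `{y, v}` and `insert y X`, and in both cases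
`x` sees `y` as it sees `X`. -/
theorem IsPrimeSet.outer_of_pair_not_prime (hc : IsReversible c) (hX : IsPrimeSet c X)
    (h3 : ∀ u v, ∃ w ∈ X, w ≠ u ∧ w ≠ v) {x y : α} (hx : x ∉ X) (hy : y ∉ X)
    (hox : IsOuter c X x) (hoy : ¬ IsOuter c X y)
    (h : ¬ IsPrimeSet c (insert x (insert y X))) : IsOuter c (insert y X) x := by
  have hxy : x ≠ y := by rintro rfl; exact hoy hox
  obtain ⟨M, hM, hnt, hne⟩ := exists_nontrivial_module h
  have hsub : X ⊆ insert x (insert y X) := fun _ h => Or.inr (Or.inr h)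
  rcases hX _ (hM.inter hsub) with h1 | h1
  · by_cases hxM : x ∈ M
    · exfalso
      by_cases hv : ∃ v ∈ M, v ∈ X
      · obtain ⟨v, hvM, hvX⟩ := hv
        refine hX.not_uniform h3 hvX fun a ha b hb hav hbv => ?_
        have haM : a ∉ M := fun h => hav (h1 ⟨h, ha⟩ ⟨hvM, hvX⟩)
        have hbM : b ∉ M := fun h => hbv (h1 ⟨h, hb⟩ ⟨hvM, hvX⟩)
        have e1 := hM.2 a (hsub ha) haM x hxM v hvM
        have e2 := hM.2 b (hsub hb) hbM x hxM v hvM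
        have hax : a ≠ x := by rintro rfl; exact hx ha
        have hbx : b ≠ x := by rintro rfl; exact hx hb
        rw [← hc _ _ _ _ hax hav e1, ← hc _ _ _ _ hbx hbv e2]
        exact hox a ha b hb
      · push Not at hv
        obtain ⟨z, hz, hzx⟩ := hnt.exists_ne x
        have hzy : z = y := by
          rcases hM.1 hz with h | h | h
          · exact absurd h hzx
          · exact h
          · exact absurd h (hv z hz)
        subst hzy
        refine hoy fun a ha b hb => ?_
        have e1 := hM.2 a (hsub ha) (fun h => hv a h ha) x hxM z hz
        have e2 := hM.2 b (hsub hb) (fun h => hv b h hb) x hxM z hz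
        have hax : a ≠ x := by rintro rfl; exact hx ha
        have hbx : b ≠ x := by rintro rfl; exact hx hb
        have hay : a ≠ z := by rintro rfl; exact hy ha
        have hby : b ≠ z := by rintro rfl; exact hy hb
        rw [← hc _ _ _ _ hax hay e1, ← hc _ _ _ _ hbx hby e2]
        exact hox a ha b hb
    · have hex : y ∈ M ∧ ∃ v ∈ M, v ∈ X := by
        obtain ⟨a, ha, b, hb, hab⟩ := hnt
        have ha' := hM.1 ha
        have hb' := hM.1 hb
        rcases ha' with rfl | rfl | haX
        · exact absurd ha hxM
        · rcases hb' with rfl | rfl | hbX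
          · exact absurd hb hxM
          · exact absurd rfl hab
          · exact ⟨ha, b, hb, hbX⟩
        · rcases hb' with rfl | rfl | hbX
          · exact absurd hb hxM
          · exact ⟨hb, a, ha, haX⟩
          · exact absurd (h1 ⟨ha, haX⟩ ⟨hb, hbX⟩) hab
      obtain ⟨hyM, v, hvM, hvX⟩ := hex
      have e := hM.2 x (Or.inl rfl) hxM y hyM v hvM
      intro a ha b hb
      have key : ∀ a ∈ insert y X, c x a = c x v := by
        rintro a (rfl | ha)
        · exact e
        · exact hox a ha v hvX
      rw [key a ha, key b hb]
  · have hXM : X ⊆ M := Set.inter_eq_right.mp h1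
    have hyM : y ∈ M := by
      by_contra hyM
      exact hoy fun a ha b hb => hM.2 y (Or.inr (Or.inl rfl)) hyM a (hXM ha) b (hXM hb)
    have hxM : x ∉ M := fun hxM =>
      hne (hM.1.antisymm (Set.insert_subset hxM (Set.insert_subset hyM hXM)))
    have hs : insert y X ⊆ M := Set.insert_subset hyM hXM
    exact fun a ha b hb => hM.2 x (Or.inl rfl) hxM a (hs ha) b (hs hb)

/-- This makes `u` together with its twins outside `X` a module of the whole structure: points
outside this class do not separate it. The proof again goes through the possible traces on `X` of a
nontrivial module. -/
theorem IsPrimeSet.twin_of_pair_not_prime (hc : IsReversible c) (hX : IsPrimeSet c X)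
    (h3 : ∀ u v, ∃ w ∈ X, w ≠ u ∧ w ≠ v) {u x y : α} (hx : x ∉ X) (hy : y ∉ X)
    (htx : IsTwin c X u x) (hty : ¬ IsTwin c X u y)
    (h : ¬ IsPrimeSet c (insert x (insert y X))) : c y u = c y x := by
  have hxy : x ≠ y := by rintro rfl; exact hty htx
  have huX := htx.1
  obtain ⟨M, hM, hnt, hne⟩ := exists_nontrivial_module h
  have hsub : X ⊆ insert x (insert y X) := fun _ h => Or.inr (Or.inr h)
  have nx : ∀ a ∈ X, a ≠ x := by rintro a ha rfl; exact hx ha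
  have ny : ∀ a ∈ X, a ≠ y := by rintro a ha rfl; exact hy ha
  rcases hX _ (hM.inter hsub) with h1 | h1
  · by_cases hv : ∃ v ∈ M, v ∈ X
    · obtain ⟨v, hvM, hvX⟩ := hv
      have hout : ∀ w ∈ X, w ≠ v → w ∉ M := fun w hw hwv h => hwv (h1 ⟨h, hw⟩ ⟨hvM, hvX⟩)
      by_cases hxM : x ∈ M
      · by_cases hvu : v = u
        · subst hvu
          by_cases hyM : y ∈ M
          · exact absurd ⟨hvX, fun w hw hwv => hM.2 w (hsub hw) (hout w hw hwv) v hvM y hyM⟩ hty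
          · exact hM.2 y (Or.inr (Or.inl rfl)) hyM v hvM x hxM
        · exfalso
          refine hX.not_twins h3 hvX huX hvu fun w hw hwv hwu => ?_
          rw [htx.2 w hw hwu]
          exact hM.2 w (hsub hw) (hout w hw hwv) v hvM x hxM
      · have hyM : y ∈ M := by
          obtain ⟨z, hz, hzv⟩ := hnt.exists_ne v
          rcases hM.1 hz with h | h | h
          · exact absurd (h ▸ hz) hxM
          · exact h ▸ hz
          · exact absurd hz (hout z h hzv)
        by_cases hvu : v = u
        · subst hvu
          exact absurd ⟨hvX, fun w hw hwv => hM.2 w (hsub hw) (hout w hw hwv) v hvM y hyM⟩ hty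
        · have e1 := hM.2 x (Or.inl rfl) hxM y hyM v hvM
          have e2 := htx.2 v hvX hvu
          have e3 := hM.2 u (hsub huX) (hout u huX (Ne.symm hvu)) y hyM v hvM
          have e1' := hc _ _ _ _ hxy (nx v hvX).symm e1
          have e3' := hc _ _ _ _ (ny u huX) (Ne.symm hvu) e3
          rw [e1', e3', e2]
    · exfalso
      push Not at hv
      have hboth : x ∈ M ∧ y ∈ M := by
        obtain ⟨a, ha, b, hb, hab⟩ := hnt
        rcases hM.1 ha with rfl | rfl | haX
        · rcases hM.1 hb with rfl | rfl | hbX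
          · exact absurd rfl hab
          · exact ⟨ha, hb⟩
          · exact absurd hbX (hv b hb)
        · rcases hM.1 hb with rfl | rfl | hbX
          · exact ⟨hb, ha⟩
          · exact absurd rfl hab
          · exact absurd hbX (hv b hb)
        · exact absurd haX (hv a ha)
      refine hty ⟨huX, fun w hw hwu => ?_⟩
      rw [htx.2 w hw hwu]
      exact hM.2 w (hsub hw) (fun h => hv w h hw) x hboth.1 y hboth.2
  · have hXM : X ⊆ M := Set.inter_eq_right.mp h1
    by_cases hxM : x ∈ M
    · have hyM : y ∉ M := fun hyM =>
        hne (hM.1.antisymm (Set.insert_subset hxM (Set.insert_subset hyM hXM)))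
      exact hM.2 y (Or.inr (Or.inl rfl)) hyM u (hXM huX) x hxM
    · exfalso
      refine hX.not_uniform h3 huX fun a ha b hb hau hbu => ?_
      have e1 := hc _ _ _ _ hau (nx a ha) (htx.2 a ha hau)
      have e2 := hc _ _ _ _ hbu (nx b hb) (htx.2 b hb hbu)
      rw [e1, e2]
      exact hM.2 x (Or.inl rfl) hxM a (hXM ha) b (hXM hb)

/-- A prime set with at least two points outside, none of which can be added to it alone, can be
extended by two points, provided that the whole structure is prime. -/
theorem IsPrimeSet.exists_pair (hc : IsReversible c) (hX : IsPrimeSet c X)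
    (h3 : ∀ u v, ∃ w ∈ X, w ≠ u ∧ w ≠ v) (huniv : IsPrimeSet c Set.univ) (hXne : X ≠ Set.univ)
    (hext : ∀ x ∉ X, ¬ IsPrimeSet c (insert x X)) :
    ∃ x ∉ X, ∃ y ∉ X, x ≠ y ∧ IsPrimeSet c (insert x (insert y X)) := by
  by_contra hcon
  push Not at hcon
  obtain ⟨x₀, hx₀⟩ := (Set.ne_univ_iff_exists_notMem X).mp hXne
  obtain ⟨a, haX, -⟩ := h3 x₀ x₀
  obtain ⟨b, hbX, hba, -⟩ := h3 a a
  by_cases hO : ∃ x ∉ X, IsOuter c X x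
  · obtain ⟨x, hx, hxO⟩ := hO
    -- Each outer point outside `X` sees `X` and all non-outer points alike, so these form a module,
    -- which contains `X` and misses `x`.
    rcases huniv {z | z ∈ X ∨ ¬ IsOuter c X z} ⟨Set.subset_univ _, fun v _ hv y hy z hz => by
      simp only [Set.mem_ofPred_eq, not_or, not_not] at hv hy hz
      have key : ∀ y, y ∈ X ∨ ¬ IsOuter c X y → c v y = c v a := by
        intro y hy
        by_cases hyX : y ∈ X
        · exact hv.2 y hyX a haX
        · have hyO := hy.resolve_left hyX
          have hvy : v ≠ y := by rintro rfl; exact hyO hv.2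
          exact hX.outer_of_pair_not_prime hc h3 hv.1 hyX hv.2 hyO (hcon v hv.1 y hyX hvy)
            y (Or.inl rfl) a (Or.inr haX)
      rw [key y hy, key z hz]⟩ with h | h
    · exact hba (h (Or.inl hbX) (Or.inl haX))
    · have : x ∈ {z | z ∈ X ∨ ¬ IsOuter c X z} := h ▸ Set.mem_univ x
      exact this.elim hx (fun h => h hxO)
  · push Not at hO
    obtain ⟨u, hu⟩ := (hX.outer_or_twin (hext x₀ hx₀)).resolve_left (hO x₀ hx₀)
    have key : ∀ v, v ≠ u → ¬ (v ∉ X ∧ IsTwin c X u v) → ∀ y, y ∉ X → IsTwin c X u y →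
        c v u = c v y := by
      intro v hvu hv y hy hty
      by_cases hvX : v ∈ X
      · exact hty.2 v hvX hvu
      · have hvt : ¬ IsTwin c X u v := fun h => hv ⟨hvX, h⟩
        have hyv : y ≠ v := by rintro rfl; exact hvt hty
        exact hX.twin_of_pair_not_prime hc h3 hy hvX hty hvt (hcon y hy v hvX hyv)
    -- With no outer points, the twin class of `u` is a module; it contains `u` and `x₀` and misses
    -- the rest of `X`.
    rcases huniv {z | z = u ∨ z ∉ X ∧ IsTwin c X u z} ⟨Set.subset_univ _, fun v _ hv y hy z hz => by
      simp only [Set.mem_ofPred_eq, not_or] at hv hy hz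
      have key' : ∀ y, y = u ∨ y ∉ X ∧ IsTwin c X u y → c v u = c v y := by
        rintro y (rfl | hy)
        · rfl
        · exact key v hv.1 hv.2 y hy.1 hy.2
      rw [← key' y hy, ← key' z hz]⟩ with h | h
    · have := h (Or.inl rfl) (Or.inr ⟨hx₀, hu⟩)
      exact hx₀ (this ▸ hu.1)
    · obtain ⟨w, hw, hwu, -⟩ := h3 u u
      have : w ∈ {z | z = u ∨ z ∉ X ∧ IsTwin c X u z} := h ▸ Set.mem_univ w
      exact this.elim hwu (fun h => h.1 hw)

/-- A proper prime subset of a prime structure is contained in a prime set that misses one or two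
points. -/
theorem IsPrimeSet.exists_large [Finite α] (hc : IsReversible c) (hX : IsPrimeSet c X)
    (h3 : ∀ u v, ∃ w ∈ X, w ≠ u ∧ w ≠ v) (huniv : IsPrimeSet c Set.univ) (hXne : X ≠ Set.univ) :
    ∃ Y, X ⊆ Y ∧ IsPrimeSet c Y ∧ ((∃ v, Y = {v}ᶜ) ∨ ∃ x y, x ≠ y ∧ Y = {x, y}ᶜ) := by
  obtain ⟨Y, hXY, hY⟩ := (Set.toFinite {Y : Set α | IsPrimeSet c Y ∧ Y ≠ Set.univ}).exists_le_maximal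
    (a := X) ⟨hX, hXne⟩
  have hXY : X ⊆ Y := hXY
  have hmax : ∀ Z, IsPrimeSet c Z → Y ⊆ Z → Z ≠ Y → Z = Set.univ := by
    intro Z hZ hYZ hne
    by_contra hu
    exact hne (Set.Subset.antisymm (hY.2 ⟨hZ, hu⟩ hYZ) hYZ)
  have h3Y : ∀ u v, ∃ w ∈ Y, w ≠ u ∧ w ≠ v := fun u v =>
    let ⟨w, hw, h⟩ := h3 u v; ⟨w, hXY hw, h⟩
  refine ⟨Y, hXY, hY.1.1, ?_⟩
  by_cases hext : ∃ v ∉ Y, IsPrimeSet c (insert v Y)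
  · obtain ⟨v, hv, hp⟩ := hext
    left
    refine ⟨v, ?_⟩
    have hu := hmax _ hp (Set.subset_insert v Y) (fun h => hv (h ▸ Set.mem_insert v Y))
    ext z
    have : z ∈ insert v Y := hu ▸ Set.mem_univ z
    simp only [Set.mem_insert_iff, Set.mem_compl_iff, Set.mem_singleton_iff] at this ⊢
    constructor
    · rintro hz rfl; exact hv hz
    · exact fun hz => this.resolve_left hz
  · push Not at hext
    obtain ⟨x, hx, y, hy, hxy, hp⟩ := hY.1.1.exists_pair hc h3Y huniv hY.1.2 hext
    right
    refine ⟨x, y, hxy, ?_⟩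
    have hu := hmax _ hp (fun _ h => Or.inr (Or.inr h)) (fun h => hx (h ▸ Set.mem_insert x _))
    ext z
    have : z ∈ insert x (insert y Y) := hu ▸ Set.mem_univ z
    simp only [Set.mem_insert_iff, Set.mem_compl_iff, Set.mem_singleton_iff, not_or] at this ⊢
    constructor
    · intro hz
      exact ⟨by rintro rfl; exact hx hz, by rintro rfl; exact hy hz⟩
    · rintro ⟨h1, h2⟩
      exact (this.resolve_left h1).resolve_left h2

end Prime

section Prime

variable {α β κ κ' : Type*}

/-- The recolouring `e` is the identity for occurrences of patterns and the swap of the two orders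
for inverses. -/
theorem isPrimeSet_range_iff {c : α → α → κ} {c' : β → β → κ'} {f : α → β} {e : κ → κ'}
    (he : e.Injective) (hf : f.Injective) (h : ∀ a b, c' (f a) (f b) = e (c a b)) :
    IsPrimeSet c' (Set.range f) ↔ IsPrimeSet c Set.univ := by
  constructor
  · intro hp M hM
    have hmod : IsModuleOf c' (Set.range f) (f '' M) := by
      refine ⟨Set.image_subset_range f M, ?_⟩
      rintro _ ⟨v, rfl⟩ hv _ ⟨x, hx, rfl⟩ _ ⟨y, hy, rfl⟩
      rw [h, h, hM.2 v trivial (fun hvM => hv ⟨v, hvM, rfl⟩) x hx y hy]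
    rcases hp _ hmod with h1 | h1
    · exact Or.inl (Set.subsingleton_of_image hf M h1)
    · right
      rw [← Set.image_univ] at h1
      exact hf.image_injective h1
  · intro hp M hM
    obtain ⟨N, rfl⟩ := Set.subset_range_iff_exists_image_eq.mp hM.1
    have hmod : IsModuleOf c Set.univ N := by
      refine ⟨Set.subset_univ _, fun v _ hv x hx y hy => he ?_⟩
      rw [← h, ← h]
      refine hM.2 _ ⟨v, rfl⟩ ?_ _ ⟨x, hx, rfl⟩ _ ⟨y, hy, rfl⟩
      rintro ⟨w, hw, hwv⟩
      exact hv (hf hwv ▸ hw)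
    rcases hp N hmod with h1 | h1
    · exact Or.inl (h1.image f)
    · right; rw [h1, Set.image_univ]

end Prime

/-! ### Permutations as coloured structures: simplicity, occurrences, inverses. -/

/-- The relative position of two entries, in the orders by position and by value. -/
def code (σ : Permutation) (a b : Fin σ.size) : Bool × Bool :=
  (decide (a < b), decide (σ.2 a < σ.2 b))

theorem code_eq_iff {σ τ : Permutation} {a b : Fin σ.size} {d e : Fin τ.size} :
    σ.code a b = τ.code d e ↔ (a < b ↔ d < e) ∧ (σ.2 a < σ.2 b ↔ τ.2 d < τ.2 e) := by
  simp [code]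

theorem lt_or_gt_value (σ : Permutation) {a b : Fin σ.size} (h : a ≠ b) :
    σ.2 a < σ.2 b ∨ σ.2 b < σ.2 a :=
  lt_or_gt_of_ne (fun h' => h (σ.2.injective h'))

theorem isReversible_code (σ : Permutation) : IsReversible σ.code := by
  intro a b d e hab hde h
  rw [code_eq_iff] at h ⊢
  have h1 := σ.lt_or_gt_value hab
  have h2 := σ.lt_or_gt_value hde
  constructor <;> omega

/-- A point outside a module cannot lie between two of its points in either order, so a nonempty
module fills the range between its extremes both by position and by value. -/
theorem isSimple_iff (σ : Permutation) : σ.IsSimple ↔ IsPrimeSet σ.code Set.univ := by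
  constructor
  · intro h M hM
    rcases M.eq_empty_or_nonempty with rfl | hne
    · exact Or.inl Set.subsingleton_empty
    have hval : ∀ N : Set (Fin σ.size), N.Nonempty → ∃ i ∈ N, ∃ j ∈ N, ∀ k ∈ N, i ≤ k ∧ k ≤ j := by
      intro N hN
      obtain ⟨i, hi, hi'⟩ := N.toFinite.exists_minimalFor id N hN
      obtain ⟨j, hj, hj'⟩ := N.toFinite.exists_maximalFor id N hN
      exact ⟨i, hi, j, hj, fun k hk => ⟨(le_total i k).elim id (hi' hk), (le_total k j).elim id (hj' hk)⟩⟩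
    obtain ⟨i, hi, j, hj, hij⟩ := hval M hne
    obtain ⟨a, ⟨a, ha, rfl⟩, b, ⟨b, hb, rfl⟩, hab⟩ := hval (σ.2 '' M) (hne.image _)
    have hIcc : M = Set.Icc i j := by
      ext v
      refine ⟨hij v, fun hv => ?_⟩
      by_contra hvM
      have h1 := (code_eq_iff.mp (hM.2 v trivial hvM i hi j hj)).1
      have hvi : v ≠ i := by rintro rfl; exact hvM hi
      have hvj : v ≠ j := by rintro rfl; exact hvM hj
      have h2 := hv.1
      have h3 := hv.2
      omega
    have hImg : σ.2 '' M = Set.Icc (σ.2 a) (σ.2 b) := by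
      ext w
      refine ⟨hab w, fun hw => ?_⟩
      obtain ⟨v, rfl⟩ := σ.2.surjective w
      by_contra hvM'
      have hvM : v ∉ M := fun h => hvM' ⟨v, h, rfl⟩
      have h1 := (code_eq_iff.mp (hM.2 v trivial hvM a ha b hb)).2
      have hva : v ≠ a := by rintro rfl; exact hvM ha
      have hvb : v ≠ b := by rintro rfl; exact hvM hb
      have h2 := hw.1
      have h3 := hw.2
      have h4 := σ.lt_or_gt_value hva
      have h5 := σ.lt_or_gt_value hvb
      omega
    rcases h i j ⟨(hij i hi).2, _, _, hIcc ▸ hImg⟩ with h | h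
    · left
      rw [hIcc, h, Set.Icc_self]
      exact Set.subsingleton_singleton
    · right; rw [hIcc, h]
  · rintro h i j ⟨hij, a, b, hab⟩
    have hmod : IsModuleOf σ.code Set.univ (Set.Icc i j) := by
      refine ⟨Set.subset_univ _, fun v _ hv x hx y hy => ?_⟩
      have hx' : σ.2 x ∈ Set.Icc a b := hab ▸ ⟨x, hx, rfl⟩
      have hy' : σ.2 y ∈ Set.Icc a b := hab ▸ ⟨y, hy, rfl⟩
      have hv' : σ.2 v ∉ Set.Icc a b := by
        rw [← hab]
        rintro ⟨w, hw, hwv⟩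
        exact hv (σ.2.injective hwv ▸ hw)
      rw [code_eq_iff]
      simp only [Set.mem_Icc] at *
      constructor <;> omega
    exact (h _ hmod).imp_left fun h => h ⟨le_rfl, hij⟩ ⟨hij, le_rfl⟩

/-- `f` realises `π` as a pattern of `σ`. -/
def IsOccurrence (π σ : Permutation) (f : Fin π.size → Fin σ.size) : Prop :=
  ∀ a b, σ.code (f a) (f b) = π.code a b

section Occurrence

variable {π σ τ : Permutation} {f : Fin π.size → Fin σ.size}

theorem IsOccurrence.lt_iff (h : IsOccurrence π σ f) {a b : Fin π.size} : f a < f b ↔ a < b :=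
  (code_eq_iff.mp (h a b)).1

theorem IsOccurrence.value_lt_iff (h : IsOccurrence π σ f) {a b : Fin π.size} :
    σ.2 (f a) < σ.2 (f b) ↔ π.2 a < π.2 b :=
  (code_eq_iff.mp (h a b)).2

theorem IsOccurrence.strictMono (h : IsOccurrence π σ f) : StrictMono f :=
  fun _ _ hab => h.lt_iff.mpr hab

theorem isPattern_iff : π.IsPattern σ ↔ ∃ f, IsOccurrence π σ f := by
  constructor
  · rintro ⟨f, hf, h⟩
    exact ⟨f, fun a b => code_eq_iff.mpr ⟨hf.lt_iff_lt, (h a b).symm⟩⟩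
  · rintro ⟨f, hf⟩
    exact ⟨f, hf.strictMono, fun a b => hf.value_lt_iff.symm⟩

theorem IsOccurrence.isPrimeSet_range_iff (h : IsOccurrence π σ f) :
    IsPrimeSet σ.code (Set.range f) ↔ π.IsSimple := by
  rw [isSimple_iff]
  exact Permutation.isPrimeSet_range_iff (e := id) Function.injective_id h.strictMono.injective h

theorem IsOccurrence.ncard_range (h : IsOccurrence π σ f) : (Set.range f).ncard = π.size := by
  rw [← Set.image_univ, Set.ncard_image_of_injective _ h.strictMono.injective, Set.ncard_univ,
    Nat.card_fin]

theorem IsOccurrence.exists_third (h : IsOccurrence π σ f) (h3 : 3 ≤ π.size) (u v : Fin σ.size) :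
    ∃ w ∈ Set.range f, w ≠ u ∧ w ≠ v := by
  have h2 : ({u, v} : Set (Fin σ.size)).ncard < (Set.range f).ncard := by
    rw [h.ncard_range]
    exact lt_of_le_of_lt (Set.ncard_insert_le u {v}) (by rw [Set.ncard_singleton]; omega)
  obtain ⟨w, hw, hw'⟩ := Set.exists_mem_notMem_of_ncard_lt_ncard h2
  simp only [Set.mem_insert_iff, Set.mem_singleton_iff, not_or] at hw'
  exact ⟨w, hw, hw'⟩

theorem IsOccurrence.isPattern (h : IsOccurrence π σ f) : π.IsPattern σ :=
  isPattern_iff.mpr ⟨f, h⟩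

theorem IsOccurrence.isPattern_of_range_subset {g : Fin τ.size → Fin σ.size}
    (hf : IsOccurrence π σ f) (hg : IsOccurrence τ σ g) (h : Set.range f ⊆ Set.range g) :
    π.IsPattern τ := by
  have h' : ∀ a, ∃ b, g b = f a := fun a => h ⟨a, rfl⟩
  choose k hk using h'
  refine isPattern_iff.mpr ⟨k, fun a b => ?_⟩
  rw [← hf, ← hg, hk, hk]

theorem exists_occurrence (σ : Permutation) (S : Set (Fin σ.size)) :
    ∃ (τ : Permutation) (f : Fin τ.size → Fin σ.size), IsOccurrence τ σ f ∧ Set.range f = S := by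
  classical
  let s := S.toFinite.toFinset
  let f := s.orderIsoOfFin rfl
  have hc : (s.image σ.2).card = s.card := Finset.card_image_of_injective _ σ.2.injective
  let g := (s.image σ.2).orderIsoOfFin hc
  let t : Fin s.card → Fin s.card :=
    fun i => g.symm ⟨σ.2 (f i), Finset.mem_image_of_mem _ (f i).2⟩
  have ht : Function.Injective t := by
    intro i j hij
    have := g.symm.injective hij
    rw [Subtype.mk.injEq] at this
    exact f.injective (Subtype.ext (σ.2.injective this))
  refine ⟨⟨s.card, Equiv.ofBijective t (Finite.injective_iff_bijective.mp ht)⟩, fun i => f i, ?_, ?_⟩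
  · intro a b
    rw [code_eq_iff]
    constructor
    · exact f.lt_iff_lt
    · change _ ↔ t a < t b
      rw [g.symm.lt_iff_lt]
      rfl
  · ext x
    constructor
    · rintro ⟨i, rfl⟩
      exact S.toFinite.mem_toFinset.mp (f i).2
    · intro hx
      exact ⟨f.symm ⟨x, S.toFinite.mem_toFinset.mpr hx⟩, by simp⟩

theorem strictMono_surjective_eq_id {n : ℕ} {f : Fin n → Fin n} (hf : StrictMono f)
    (hs : Function.Surjective f) : f = id := by
  funext i
  exact congrArg (fun e : Fin n ≃o Fin n => e i)
    (Subsingleton.elim (hf.orderIsoOfSurjective f hs) (OrderIso.refl _))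

theorem eq_of_forall_lt_iff {n : ℕ} {p q : Equiv.Perm (Fin n)}
    (h : ∀ a b, p a < p b ↔ q a < q b) : p = q := by
  have hm : StrictMono (fun i => p (q.symm i)) := by
    intro i j hij
    rw [h]
    simpa using hij
  have := strictMono_surjective_eq_id hm (p.surjective.comp q.symm.surjective)
  ext i
  have := congrFun this (q i)
  simp at this
  rw [this]

theorem IsOccurrence.eq_of_surjective (h : IsOccurrence π σ f) (hs : Function.Surjective f) :
    π = σ := by
  have hsize : π.size = σ.size := by
    simpa using Fintype.card_of_bijective ⟨h.strictMono.injective, hs⟩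
  obtain ⟨n, p⟩ := π
  obtain ⟨n', q⟩ := σ
  obtain rfl : n = n' := hsize
  have hf : f = id := strictMono_surjective_eq_id h.strictMono hs
  subst hf
  have hpq : p = q := eq_of_forall_lt_iff fun a b => h.value_lt_iff.symm
  rw [hpq]

end Occurrence

/-- The inverse permutation. -/
def inverse (σ : Permutation) : Permutation := ⟨σ.size, σ.2⁻¹⟩

theorem code_inverse (σ : Permutation) (a b : Fin σ.size) :
    σ.inverse.code (σ.2 a) (σ.2 b) = (σ.code a b).swap :=
  Prod.ext rfl (congrArg₂ (fun x y : Fin σ.size => decide (x < y)) (σ.2.symm_apply_apply a)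
    (σ.2.symm_apply_apply b))

theorem IsSimple.inverse {σ : Permutation} (h : σ.IsSimple) : σ.inverse.IsSimple := by
  rw [isSimple_iff] at h ⊢
  have := (isPrimeSet_range_iff (c' := σ.inverse.code) (f := (σ.2 : Fin σ.size → Fin σ.size))
    (e := Prod.swap) Prod.swap_injective σ.2.injective σ.code_inverse).mpr h
  have hr : Set.range (σ.2 : Fin σ.size → Fin σ.size) = Set.univ := σ.2.surjective.range_eq
  exact hr ▸ this

theorem IsOccurrence.inverse {π σ : Permutation} {f : Fin π.size → Fin σ.size}
    (h : IsOccurrence π σ f) :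
    IsOccurrence π.inverse σ.inverse (fun i => σ.2 (f (π.2.symm i))) := by
  intro a b
  change Fin π.size at a b
  obtain ⟨a, rfl⟩ := π.2.surjective a
  obtain ⟨b, rfl⟩ := π.2.surjective b
  refine Eq.trans ?_ (π.code_inverse a b).symm
  simp only [Equiv.symm_apply_apply]
  rw [σ.code_inverse, h]

theorem IsPattern.inverse {π σ : Permutation} (h : π.IsPattern σ) :
    π.inverse.IsPattern σ.inverse := by
  obtain ⟨f, hf⟩ := isPattern_iff.mp h
  exact hf.inverse.isPattern

theorem exists_ne_three {n : ℕ} (hn : 4 ≤ n) (x y z : Fin n) : ∃ w, w ≠ x ∧ w ≠ y ∧ w ≠ z := by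
  have h : ({x, y, z} : Finset (Fin n)).card < (Finset.univ : Finset (Fin n)).card := by
    rw [Finset.card_univ, Fintype.card_fin]
    exact lt_of_le_of_lt Finset.card_le_three hn
  obtain ⟨w, -, hw⟩ := Finset.exists_mem_notMem_of_card_lt_card h
  exact ⟨w, by simpa using hw⟩

/-! ### Twins after a deletion, and the exchange argument. -/

/-- `e y` and `e z` are consecutive. -/
def IsAdj {n : ℕ} (e : Equiv.Perm (Fin n)) (y z : Fin n) : Prop :=
  (e y : ℕ) + 1 = e z ∨ (e z : ℕ) + 1 = e y

/-- `e y`, `e x`, `e z` are consecutive, in this order or the reversed one. -/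
def IsMid {n : ℕ} (e : Equiv.Perm (Fin n)) (x y z : Fin n) : Prop :=
  (e y : ℕ) + 1 = e x ∧ (e x : ℕ) + 1 = e z ∨ (e z : ℕ) + 1 = e x ∧ (e x : ℕ) + 1 = e y

section Order

variable {n : ℕ} {e : Equiv.Perm (Fin n)} {x y z : Fin n}

theorem succ_of_no_between (h : e y < e z) (hno : ∀ w, e y < e w → e w < e z → False) :
    (e y : ℕ) + 1 = e z := by
  by_contra hne
  have h1 : (e y : ℕ) + 1 < n := by omega
  have h2 := e.apply_symm_apply ⟨(e y : ℕ) + 1, h1⟩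
  refine hno (e.symm ⟨(e y : ℕ) + 1, h1⟩) ?_ ?_ <;> rw [h2, Fin.lt_def] <;> simp only <;> omega

theorem lt_or_gt_apply (e : Equiv.Perm (Fin n)) (h : x ≠ y) : e x < e y ∨ e y < e x :=
  lt_or_gt_of_ne fun h' => h (e.injective h')

theorem isAdj_of_no_between (hyz : y ≠ z)
    (hno : ∀ w, w ≠ y → w ≠ z → (e w < e y ↔ e w < e z)) : IsAdj e y z := by
  have key : ∀ w, ¬ (e y < e w ∧ e w < e z) ∧ ¬ (e z < e w ∧ e w < e y) := by
    intro w
    by_cases hy : w = y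
    · subst hy; constructor <;> rintro ⟨h1, h2⟩ <;> omega
    by_cases hz : w = z
    · subst hz; constructor <;> rintro ⟨h1, h2⟩ <;> omega
    have := hno w hy hz
    have := lt_or_gt_apply e hy
    have := lt_or_gt_apply e hz
    constructor <;> rintro ⟨h1, h2⟩ <;> omega
  rcases lt_or_gt_apply e hyz with h | h
  · exact Or.inl (succ_of_no_between h fun w h1 h2 => (key w).1 ⟨h1, h2⟩)
  · exact Or.inr (succ_of_no_between h fun w h1 h2 => (key w).2 ⟨h1, h2⟩)

theorem isMid_of_no_other_between (hxy : x ≠ y) (hxz : x ≠ z)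
    (hno : ∀ w, w ≠ x → w ≠ y → w ≠ z → (e w < e y ↔ e w < e z))
    (hx : ¬ (e x < e y ↔ e x < e z)) : IsMid e x y z := by
  have h1 := lt_or_gt_apply e hxy
  have h2 := lt_or_gt_apply e hxz
  have key : ∀ w, w ≠ x → ¬ (e y < e w ∧ e w < e z) ∧ ¬ (e z < e w ∧ e w < e y) := by
    intro w hw
    by_cases hy : w = y
    · subst hy; constructor <;> rintro ⟨h1, h2⟩ <;> omega
    by_cases hz : w = z
    · subst hz; constructor <;> rintro ⟨h1, h2⟩ <;> omega
    have := hno w hw hy hz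
    have := lt_or_gt_apply e hy
    have := lt_or_gt_apply e hz
    constructor <;> rintro ⟨h1, h2⟩ <;> omega
  have ne : ∀ w, e w < e x ∨ e x < e w → w ≠ x := by
    rintro w h rfl; omega
  by_cases h : e x < e y
  · have hz : e z < e x := by omega
    right
    refine ⟨succ_of_no_between hz fun w h3 h4 => (key w (ne w (Or.inl h4))).2 ⟨h3, ?_⟩,
      succ_of_no_between h fun w h3 h4 => (key w (ne w (Or.inr h3))).2 ⟨?_, h4⟩⟩ <;> omega
  · have hy : e y < e x := by omega
    have hz : e x < e z := by omega
    left
    refine ⟨succ_of_no_between hy fun w h3 h4 => (key w (ne w (Or.inl h4))).1 ⟨h3, ?_⟩,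
      succ_of_no_between hz fun w h3 h4 => (key w (ne w (Or.inr h3))).1 ⟨?_, h4⟩⟩ <;> omega

end Order

variable {π σ τ : Permutation}

/-- In a simple permutation, three entries are always distinguished by a fourth one. -/
theorem IsSimple.exists_distinguishes_three (hσ : σ.IsSimple) (h4 : 4 ≤ σ.size)
    {x y z : Fin σ.size} (hxy : x ≠ y) :
    ∃ w, w ≠ x ∧ w ≠ y ∧ w ≠ z ∧ ¬ (σ.code w x = σ.code w y ∧ σ.code w x = σ.code w z) := by
  by_contra hcon
  push Not at hcon
  obtain ⟨w, hwx, hwy, hwz⟩ := exists_ne_three h4 x y z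
  rcases (isSimple_iff σ).mp hσ {x, y, z} ⟨Set.subset_univ _, fun v _ hv a ha b hb => by
    simp only [Set.mem_insert_iff, Set.mem_singleton_iff, not_or] at hv ha hb
    obtain ⟨h1, h2⟩ := hcon v hv.1 hv.2.1 hv.2.2
    rcases ha with rfl | rfl | rfl <;> rcases hb with rfl | rfl | rfl <;> simp [← h1, ← h2]⟩ with h | h
  · exact hxy (h (by simp) (by simp))
  · have : w ∈ ({x, y, z} : Set (Fin σ.size)) := h ▸ Set.mem_univ w
    simp [hwx, hwy, hwz] at this

theorem exists_third_univ (h4 : 4 ≤ σ.size) (u v : Fin σ.size) :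
    ∃ w ∈ (Set.univ : Set (Fin σ.size)), w ≠ u ∧ w ≠ v :=
  let ⟨w, h1, h2, _⟩ := exists_ne_three h4 u v v
  ⟨w, trivial, h1, h2⟩

/-- Two entries that become twins when `x` is deleted are consecutive, up to `x`, by position
and by value, with `x` in between in exactly one of the two orders. -/
theorem IsSimple.mid_or_mid (hσ : σ.IsSimple) (h4 : 4 ≤ σ.size) {x y z : Fin σ.size}
    (hxy : x ≠ y) (hxz : x ≠ z) (hyz : y ≠ z)
    (htw : ∀ w, w ≠ x → w ≠ y → w ≠ z → σ.code w y = σ.code w z) :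
    IsMid 1 x y z ∧ IsAdj σ.2 y z ∨ IsMid σ.2 x y z ∧ IsAdj 1 y z := by
  have hp : ∀ w, w ≠ x → w ≠ y → w ≠ z → (w < y ↔ w < z) :=
    fun w h1 h2 h3 => (code_eq_iff.mp (htw w h1 h2 h3)).1
  have hv : ∀ w, w ≠ x → w ≠ y → w ≠ z → (σ.2 w < σ.2 y ↔ σ.2 w < σ.2 z) :=
    fun w h1 h2 h3 => (code_eq_iff.mp (htw w h1 h2 h3)).2
  by_cases h1 : x < y ↔ x < z
  · have hadj : IsAdj 1 y z := isAdj_of_no_between hyz fun w hwy hwz => by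
      by_cases hwx : w = x
      · subst hwx; exact h1
      · exact hp w hwx hwy hwz
    by_cases h2 : σ.2 x < σ.2 y ↔ σ.2 x < σ.2 z
    · exfalso
      refine ((isSimple_iff σ).mp hσ).not_twins (exists_third_univ h4) (u := y) (v := z)
        trivial trivial hyz fun w _ hwy hwz => ?_
      by_cases hwx : w = x
      · subst hwx; exact code_eq_iff.mpr ⟨h1, h2⟩
      · exact htw w hwx hwy hwz
    · exact Or.inr ⟨isMid_of_no_other_between hxy hxz hv h2, hadj⟩
  · by_cases h2 : σ.2 x < σ.2 y ↔ σ.2 x < σ.2 z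
    · refine Or.inl ⟨isMid_of_no_other_between hxy hxz hp h1,
        isAdj_of_no_between hyz fun w hwy hwz => ?_⟩
      by_cases hwx : w = x
      · subst hwx; exact h2
      · exact hv w hwx hwy hwz
    -- Here `x` lies between `y` and `z` in both orders, so an entry that does not separate `y` from
    -- `z` does not separate `x` from them either, and `{x, y, z}` would be a module.
    · exfalso
      obtain ⟨w, hwx, hwy, hwz, hw⟩ := hσ.exists_distinguishes_three h4 (x := x) (y := y) (z := z) hxy
      apply hw
      have e1 := hp w hwx hwy hwz
      have e2 := hv w hwx hwy hwz
      have a1 := σ.lt_or_gt_value hwx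
      have a2 := σ.lt_or_gt_value hwy
      have a3 := σ.lt_or_gt_value hwz
      have a4 := σ.lt_or_gt_value hxy
      have a5 := σ.lt_or_gt_value hxz
      rw [code_eq_iff, code_eq_iff]
      refine ⟨⟨?_, ?_⟩, ?_, ?_⟩ <;> omega

/-- Deleting the entries `x` and `y` of `σ` leaves `π`. -/
def IsPairDeletion (π σ : Permutation) (x y : Fin σ.size) : Prop :=
  x ≠ y ∧ ∃ f, IsOccurrence π σ f ∧ Set.range f = {x, y}ᶜ

theorem IsPairDeletion.symm {x y : Fin σ.size} (h : IsPairDeletion π σ x y) :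
    IsPairDeletion π σ y x := by
  obtain ⟨h1, f, h2, h3⟩ := h
  exact ⟨h1.symm, f, h2, h3.trans (by rw [Set.pair_comm])⟩

theorem insert_compl_pair {α : Type*} {x y : α} (h : x ≠ y) :
    insert y ({x, y}ᶜ : Set α) = {x}ᶜ := by
  ext z
  by_cases hz : z = y <;> simp [hz, h.symm]

/-- If `σ` has no simple one-point deletion above `π`, and `π` arises by deleting `x` and `y`, then
`y` is a corner of `σ` without `x`, or it can be exchanged for a twin `z`. -/
theorem IsPairDeletion.outer_or_exchange (hπ : π.IsSimple)
    (H : ∀ v f, IsOccurrence π σ f → v ∉ Set.range f → ¬ IsPrimeSet σ.code {v}ᶜ)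
    {x y : Fin σ.size} (h : IsPairDeletion π σ x y) :
    IsOuter σ.code {x, y}ᶜ y ∨ ∃ z, z ≠ x ∧ z ≠ y ∧ IsPairDeletion π σ x z ∧
      ∀ w, w ≠ x → w ≠ y → w ≠ z → σ.code w y = σ.code w z := by
  obtain ⟨hxy, f, hf, hr⟩ := h
  have hprime := hf.isPrimeSet_range_iff.mpr hπ
  rw [hr] at hprime
  have hnp := H x f hf (by rw [hr]; simp)
  rw [← insert_compl_pair hxy] at hnp
  refine (hprime.outer_or_twin hnp).imp_right ?_
  rintro ⟨u, hu, htw⟩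
  simp only [Set.mem_compl_iff, Set.mem_insert_iff, Set.mem_singleton_iff, not_or] at hu htw
  have hfne : ∀ a, f a ≠ x ∧ f a ≠ y := by
    intro a
    have : f a ∈ ({x, y}ᶜ : Set (Fin σ.size)) := hr ▸ ⟨a, rfl⟩
    simpa using this
  -- The new occurrence uses `y` in the place of its twin `u`; this frees `u` for deletion.
  refine ⟨u, hu.1, hu.2, ⟨Ne.symm hu.1, fun a => if f a = u then y else f a, fun a b => ?_, ?_⟩, ?_⟩
  · rw [← hf]
    by_cases ha : f a = u <;> by_cases hb : f b = u
    · simp only [ha, hb, if_true]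
      simp [code]
    · simp only [ha, hb, if_true, if_false]
      exact (σ.isReversible_code _ _ _ _ hb (hfne b).2 (htw _ (hfne b) hb)).symm
    · simp only [ha, hb, if_true, if_false]
      exact (htw _ (hfne a) ha).symm
    · simp only [ha, hb, if_false]
  · ext z
    simp only [Set.mem_range, Set.mem_compl_iff, Set.mem_insert_iff, Set.mem_singleton_iff, not_or]
    constructor
    · rintro ⟨a, rfl⟩
      split_ifs with ha
      · exact ⟨hxy.symm, Ne.symm hu.2⟩
      · exact ⟨(hfne a).1, ha⟩
    · rintro ⟨hzx, hzu⟩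
      by_cases hzy : z = y
      · have : u ∈ Set.range f := by rw [hr]; simp [hu]
        obtain ⟨a, ha⟩ := this
        exact ⟨a, by rw [if_pos ha, hzy]⟩
      · have : z ∈ Set.range f := by rw [hr]; simp [hzx, hzy]
        obtain ⟨a, ha⟩ := this
        exact ⟨a, by rw [if_neg (ha ▸ hzu), ha]⟩
  · intro w h1 h2 h3
    exact (htw w ⟨h1, h2⟩ h3).symm

/-- Otherwise the complement of `{x, y}` would be a nontrivial module. -/
theorem IsSimple.not_outer_both (hσ : σ.IsSimple) (h4 : 4 ≤ σ.size) {x y : Fin σ.size}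
    (hx : IsOuter σ.code {x, y}ᶜ x) (hy : IsOuter σ.code {x, y}ᶜ y) : False := by
  obtain ⟨a, hax, hay, -⟩ := exists_ne_three h4 x y y
  obtain ⟨b, hbx, hby, hba⟩ := exists_ne_three h4 x y a
  rcases (isSimple_iff σ).mp hσ {x, y}ᶜ ⟨Set.subset_univ _, fun v _ hv => by
    simp only [Set.mem_compl_iff, Set.mem_insert_iff, Set.mem_singleton_iff, not_not] at hv
    rcases hv with rfl | rfl
    · exact hx
    · exact hy⟩ with h | h
  · exact hba (h (by simp [hbx, hby]) (by simp [hax, hay]))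
  · have : x ∈ ({x, y}ᶜ : Set (Fin σ.size)) := h ▸ Set.mem_univ x
    simp at this

/-- The exchange step along three consecutive positions `a`, `b`, `c`: either `c` is the last
position in this direction, or the next position can be used. -/
theorem IsPairDeletion.step (hσ : σ.IsSimple) (h4 : 4 ≤ σ.size) (hπ : π.IsSimple)
    (H : ∀ v f, IsOccurrence π σ f → v ∉ Set.range f → ¬ IsPrimeSet σ.code {v}ᶜ)
    {a b c : Fin σ.size} (h : IsPairDeletion π σ b c) (hmid : IsMid 1 b a c)
    (hadj : IsAdj σ.2 a c) :
    (IsOuter σ.code {b, c}ᶜ b ∧ ((c : ℕ) = 0 ∨ (c : ℕ) + 1 = σ.size)) ∨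
      ∃ d, IsPairDeletion π σ c d ∧ IsMid 1 c b d ∧ IsAdj σ.2 b d := by
  simp only [IsMid, Equiv.Perm.coe_one, id] at hmid
  rcases h.symm.outer_or_exchange hπ H with ho | ⟨d, hdc, hdb, hd, htw⟩
  · left
    rw [Set.pair_comm] at ho
    refine ⟨ho, ?_⟩
    by_contra hc
    push Not at hc
    have hmem : ∀ w : Fin σ.size, w ≠ b → w ≠ c → w ∈ ({b, c}ᶜ : Set (Fin σ.size)) := by
      intro w h1 h2; simp [h1, h2]
    -- If `c` had a neighbour on its far side, that neighbour and `a` would lie on opposite sides of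
    -- `b`, against `b` being outer.
    have ha := hmem a (by omega) (by omega)
    rcases hmid with hm | hm
    · have := (code_eq_iff.mp (ho a ha ⟨(c : ℕ) + 1, by omega⟩
        (hmem _ (by rw [Ne, Fin.ext_iff]; simp only; omega)
          (by rw [Ne, Fin.ext_iff]; simp only; omega)))).1
      simp only [Fin.lt_def] at this
      omega
    · have := (code_eq_iff.mp (ho a ha ⟨(c : ℕ) - 1, by omega⟩
        (hmem _ (by rw [Ne, Fin.ext_iff]; simp only; omega)
          (by rw [Ne, Fin.ext_iff]; simp only; omega)))).1
      simp only [Fin.lt_def] at this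
      omega
  · right
    refine ⟨d, hd, ?_⟩
    rcases hσ.mid_or_mid h4 h.1.symm hdc.symm hdb.symm htw with hm | ⟨hm, ha⟩
    · exact hm
    -- In this case `d` is next to `b` by position, hence equals `a`, and `c` has the middle value
    -- of the three: `a`, `b`, `c` would form an interval.
    · exfalso
      simp only [IsAdj, Equiv.Perm.coe_one, id] at ha
      obtain rfl : d = a := by omega
      obtain ⟨w, hwa, hwb, hwc, hw⟩ := hσ.exists_distinguishes_three h4 (x := d) (y := b) (z := c) hdb
      apply hw
      have a1 := σ.lt_or_gt_value hwa
      have a2 := σ.lt_or_gt_value hwb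
      have a3 := σ.lt_or_gt_value hwc
      simp only [IsMid] at hm
      rw [code_eq_iff, code_eq_iff]
      refine ⟨⟨?_, ?_⟩, ?_, ?_⟩ <;> omega

/-! ### The zigzag shape. -/

/-- Entries at distance two have consecutive values, the second entry is a corner of the
permutation without the first one, and the last but one is a corner without the last one. -/
structure IsZigzag (σ : Permutation) : Prop where
  adj : ∀ i j : Fin σ.size, (i : ℕ) + 2 = j → IsAdj σ.2 i j
  left : ∀ i j : Fin σ.size, (i : ℕ) = 0 → (j : ℕ) = 1 → IsOuter σ.code {i, j}ᶜ j
  right : ∀ i j : Fin σ.size, (i : ℕ) + 1 = σ.size → (j : ℕ) + 2 = σ.size →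
    IsOuter σ.code {i, j}ᶜ j

/-- Any two consecutive positions can be deleted, and the entries around any position
have consecutive values, as soon as this holds somewhere. -/
theorem IsPairDeletion.propagate (hσ : σ.IsSimple) (h4 : 4 ≤ σ.size) (hπ : π.IsSimple)
    (H : ∀ v f, IsOccurrence π σ f → v ∉ Set.range f → ¬ IsPrimeSet σ.code {v}ᶜ)
    {a b c : Fin σ.size} (hab : (a : ℕ) + 1 = b) (hbc : (b : ℕ) + 1 = c)
    (h1 : IsPairDeletion π σ a b) (h2 : IsPairDeletion π σ b c) (hadj : IsAdj σ.2 a c)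
    {x y z : Fin σ.size} (hxy : (x : ℕ) + 1 = y) (hyz : (y : ℕ) + 1 = z) :
    IsPairDeletion π σ x y ∧ IsPairDeletion π σ y z ∧ IsAdj σ.2 x z := by
  -- `R j` is vacuous once `j + 2` exceeds the last position, so after descending to `R 0` the
  -- upward induction needs no bound.
  let R : ℕ → Prop := fun j => ∀ x y z : Fin σ.size, (x : ℕ) = j → (y : ℕ) = j + 1 →
    (z : ℕ) = j + 2 → IsPairDeletion π σ x y ∧ IsPairDeletion π σ y z ∧ IsAdj σ.2 x z
  have hbase : R a := by
    intro x y z hx hy hz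
    obtain rfl : x = a := by omega
    obtain rfl : y = b := by omega
    obtain rfl : z = c := by omega
    exact ⟨h1, h2, hadj⟩
  have hup : ∀ j, R j → R (j + 1) := by
    intro j hj x y z hx hy hz
    obtain ⟨-, e2, e3⟩ := hj ⟨j, by omega⟩ x y rfl hx (by omega)
    rcases e2.step hσ h4 hπ H (a := ⟨j, by omega⟩)
      (Or.inl ⟨by simp only [Equiv.Perm.coe_one, id]; omega,
        by simp only [Equiv.Perm.coe_one, id]; omega⟩) e3 with ⟨-, h⟩ | ⟨d, hd, hm, ha⟩
    · omega
    · simp only [IsMid, Equiv.Perm.coe_one, id] at hm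
      obtain rfl : d = z := by omega
      exact ⟨e2, hd, ha⟩
  have hdown : ∀ j, j + 3 < σ.size → R (j + 1) → R j := by
    intro j hj3 hj x y z hx hy hz
    obtain ⟨e1, -, e3⟩ := hj y z ⟨j + 3, hj3⟩ hy (by omega) rfl
    have e3' : IsAdj σ.2 ⟨j + 3, hj3⟩ y := e3.symm
    rcases e1.symm.step hσ h4 hπ H (a := ⟨j + 3, hj3⟩)
      (Or.inr ⟨by simp only [Equiv.Perm.coe_one, id]; omega,
        by simp only [Equiv.Perm.coe_one, id]; omega⟩) e3' with ⟨-, h⟩ | ⟨d, hd, hm, ha⟩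
    · omega
    · simp only [IsMid, Equiv.Perm.coe_one, id] at hm
      obtain rfl : d = x := by omega
      exact ⟨hd.symm, e1, ha.symm⟩
  have hzero : ∀ j, j + 2 < σ.size → R j → R 0 := by
    intro j
    induction j with
    | zero => exact fun _ h => h
    | succ j ih => exact fun h h' => ih (by omega) (hdown j (by omega) h')
  have hall : ∀ j, R j := by
    intro j
    induction j with
    | zero => exact hzero a (by omega) hbase
    | succ j ih => exact hup j ih
  exact hall x x y z rfl (by omega) (by omega)

/-- At either end of the word the exchange has no next position to move to, so `IsPairDeletion.step`
must return its corner alternative. -/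
theorem IsPairDeletion.isZigzag (hσ : σ.IsSimple) (h4 : 4 ≤ σ.size) (hπ : π.IsSimple)
    (H : ∀ v f, IsOccurrence π σ f → v ∉ Set.range f → ¬ IsPrimeSet σ.code {v}ᶜ)
    {a b c : Fin σ.size} (h1 : IsPairDeletion π σ a b) (h2 : IsPairDeletion π σ b c)
    (hmid : IsMid 1 b a c) (hadj : IsAdj σ.2 a c) :
    σ.IsZigzag ∧ ∀ x y : Fin σ.size, (x : ℕ) + 1 = y → IsPairDeletion π σ x y := by
  have key : ∀ x y z : Fin σ.size, (x : ℕ) + 1 = y → (y : ℕ) + 1 = z →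
      IsPairDeletion π σ x y ∧ IsPairDeletion π σ y z ∧ IsAdj σ.2 x z := by
    intro x y z hxy hyz
    rcases hmid with ⟨e1, e2⟩ | ⟨e1, e2⟩
    · exact h1.propagate hσ h4 hπ H e1 e2 h2 hadj hxy hyz
    · exact h2.symm.propagate hσ h4 hπ H e1 e2 h1.symm hadj.symm hxy hyz
  refine ⟨⟨fun i j hij => ?_, fun i j hi hj => ?_, fun i j hi hj => ?_⟩, fun x y hxy => ?_⟩
  · exact (key i ⟨(i : ℕ) + 1, by omega⟩ j rfl (by simp only; omega)).2.2
  · obtain ⟨e1, -, e3⟩ := key i j ⟨2, by omega⟩ (by omega) (by simp only; omega)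
    rcases e1.symm.step hσ h4 hπ H (a := ⟨2, by omega⟩)
      (Or.inr ⟨by simp only [Equiv.Perm.coe_one, id]; omega,
        by simp only [Equiv.Perm.coe_one, id]; omega⟩) e3.symm with ⟨h, -⟩ | ⟨d, -, hm, -⟩
    · rwa [Set.pair_comm]
    · simp only [IsMid, Equiv.Perm.coe_one, id] at hm
      omega
  · obtain ⟨-, e2, e3⟩ := key ⟨(j : ℕ) - 1, by omega⟩ j i (by simp only; omega) (by omega)
    rcases e2.step hσ h4 hπ H (a := ⟨(j : ℕ) - 1, by omega⟩)
      (Or.inl ⟨by simp only [Equiv.Perm.coe_one, id]; omega,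
        by simp only [Equiv.Perm.coe_one, id]; omega⟩) e3 with ⟨h, -⟩ | ⟨d, -, hm, -⟩
    · rwa [Set.pair_comm]
    · simp only [IsMid, Equiv.Perm.coe_one, id] at hm
      omega
  · by_cases h : (y : ℕ) + 1 < σ.size
    · exact (key x y ⟨(y : ℕ) + 1, h⟩ hxy rfl).1
    · exact (key ⟨(x : ℕ) - 1, by omega⟩ x y (by simp only; omega) hxy).2.1

theorem IsPairDeletion.size_eq {x y : Fin σ.size} (h : IsPairDeletion π σ x y) :
    π.size + 2 = σ.size := by
  obtain ⟨hxy, f, hf, hr⟩ := h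
  have h1 := hf.ncard_range
  have h2 := Set.ncard_add_ncard_compl ({x, y} : Set (Fin σ.size))
  rw [← hr, h1, Set.ncard_pair hxy, Nat.card_fin] at h2
  omega

theorem IsZigzag.of_pairDeletion (hσ : σ.IsZigzag) {x y : Fin σ.size} (hx : (x : ℕ) = 0)
    (hy : (y : ℕ) = 1) (h : IsPairDeletion π σ x y) : π.IsZigzag := by
  have hsize := h.size_eq
  obtain ⟨hxy, f, hf, hr⟩ := h
  have hfv : ∀ i, (f i : ℕ) = i + 2 := by
    have hg : StrictMono fun i : Fin π.size => (⟨i + 2, by omega⟩ : Fin σ.size) := by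
      intro i j hij
      exact Fin.mk_lt_mk.mpr (Nat.add_lt_add_right hij 2)
    have : f = fun i : Fin π.size => (⟨i + 2, by omega⟩ : Fin σ.size) := by
      rw [← StrictMono.range_inj hf.strictMono hg, hr]
      ext z
      simp only [Set.mem_compl_iff, Set.mem_insert_iff, Set.mem_singleton_iff, not_or,
        Set.mem_range, Fin.ext_iff]
      constructor
      · intro hz
        exact ⟨⟨(z : ℕ) - 2, by omega⟩, by simp only; omega⟩
      · rintro ⟨i, hi⟩
        omega
    intro i
    rw [this]
  have hout : ∀ i j : Fin π.size, ∀ k l : Fin σ.size, (k : ℕ) = i + 2 → (l : ℕ) = j + 2 →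
      IsOuter σ.code {k, l}ᶜ l → IsOuter π.code {i, j}ᶜ j := by
    intro i j k l hk hl ho a ha b hb
    rw [← hf, ← hf]
    have h1 := hfv j
    obtain rfl : f j = l := by omega
    have h2 := hfv i
    obtain rfl : f i = k := by omega
    have hinj := hf.strictMono.injective
    apply ho <;> simpa [hinj.eq_iff] using ‹_ ∈ ({i, j}ᶜ : Set (Fin π.size))›
  have hadj : ∀ i j : Fin π.size, (i : ℕ) + 2 = j → IsAdj π.2 i j := by
    intro i j hij
    have ha := hσ.adj (f i) (f j) (by rw [hfv, hfv]; omega)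
    simp only [IsAdj] at ha
    refine isAdj_of_no_between (by omega) fun w hwi hwj => ?_
    rw [← hf.value_lt_iff, ← hf.value_lt_iff]
    have a1 := σ.lt_or_gt_value (hf.strictMono.injective.ne hwi)
    have a2 := σ.lt_or_gt_value (hf.strictMono.injective.ne hwj)
    omega
  refine ⟨hadj, fun i j hi hj a ha b hb => ?_, fun i j hi hj => ?_⟩
  · simp only [Set.mem_compl_iff, Set.mem_insert_iff, Set.mem_singleton_iff, not_or] at ha hb
    have h3 := hfv j
    -- The new second entry was the fourth one of `σ`. Its value is next to that of the old second
    -- entry `y`, which is extreme among all later entries, so it is extreme among those after it.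
    have hadj := hσ.adj y (f j) (by omega)
    have hfa := hfv a
    have hfb := hfv b
    have key : ∀ c : Fin σ.size, 2 ≤ (c : ℕ) → c ∈ ({x, y}ᶜ : Set (Fin σ.size)) := by
      intro c hc
      simp only [Set.mem_compl_iff, Set.mem_insert_iff, Set.mem_singleton_iff, not_or]
      omega
    have e1 := (code_eq_iff.mp (hσ.left x y hx hy (f j) (key _ (by omega)) (f a)
      (key _ (by omega)))).2
    have e2 := (code_eq_iff.mp (hσ.left x y hx hy (f j) (key _ (by omega)) (f b)
      (key _ (by omega)))).2
    rw [← hf, ← hf, code_eq_iff]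
    have a1 := σ.lt_or_gt_value (hf.strictMono.injective.ne ha.2)
    have a2 := σ.lt_or_gt_value (hf.strictMono.injective.ne hb.2)
    have a3 := σ.lt_or_gt_value (show y ≠ f a by omega)
    have a4 := σ.lt_or_gt_value (show y ≠ f b by omega)
    simp only [IsAdj] at hadj
    constructor
    · rw [hf.lt_iff, hf.lt_iff]; omega
    · omega
  · exact hout i j ⟨i + 2, by omega⟩ ⟨j + 2, by omega⟩ rfl rfl
      (hσ.right _ _ (by simp only; omega) (by simp only; omega))

theorem isPrimeSet_exists_pattern {v : Fin σ.size} (hp : IsPrimeSet σ.code {v}ᶜ) :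
    ∃ τ f, IsOccurrence τ σ f ∧ Set.range f = {v}ᶜ ∧ τ.IsSimple ∧ τ.size + 1 = σ.size := by
  obtain ⟨τ, f, hf, hr⟩ := exists_occurrence σ {v}ᶜ
  have h1 := hf.ncard_range
  have h2 := Set.ncard_add_ncard_compl ({v} : Set (Fin σ.size))
  rw [← hr, h1, Set.ncard_singleton, Nat.card_fin] at h2
  exact ⟨τ, f, hf, hr, hf.isPrimeSet_range_iff.mp (hr ▸ hp), by omega⟩

theorem IsPairDeletion.inverse {x y : Fin σ.size} (h : IsPairDeletion π σ x y) :
    IsPairDeletion (σ := σ.inverse) π.inverse (σ.2 x) (σ.2 y) := by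
  obtain ⟨hxy, f, hf, hr⟩ := h
  refine ⟨fun h => hxy (σ.2.injective h), _, hf.inverse, ?_⟩
  ext z
  obtain ⟨z, rfl⟩ := σ.2.surjective z
  have hz : z ∈ Set.range f ↔ z ∈ ({x, y}ᶜ : Set (Fin σ.size)) := by rw [hr]
  simp only [Set.mem_range, Set.mem_compl_iff, Set.mem_insert_iff, Set.mem_singleton_iff,
    not_or] at hz
  constructor
  · rintro ⟨i, hi⟩ hz'
    have := hz.mp ⟨_, σ.2.injective hi⟩
    rcases hz' with h | h
    · exact this.1 (σ.2.injective h)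
    · exact this.2 (σ.2.injective h)
  · intro hz'
    obtain ⟨i, hi⟩ := hz.mpr ⟨fun h => hz' (Or.inl (h ▸ rfl)), fun h => hz' (Or.inr (h ▸ rfl))⟩
    exact ⟨π.2 i, congrArg σ.2 ((congrArg f (π.2.symm_apply_apply i)).trans hi)⟩

/-- There is no simple permutation between `π` and `σ` of size one less than `σ`. -/
def HasNoLowerCover (π σ : Permutation) : Prop :=
  ∀ τ : Permutation, τ.IsSimple → τ.size + 1 = σ.size → π.IsPattern τ → ¬ τ.IsPattern σ

theorem HasNoLowerCover.inverse (h : HasNoLowerCover π σ) :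
    HasNoLowerCover π.inverse σ.inverse := fun τ hτ hs h1 h2 =>
  h τ.inverse hτ.inverse hs h1.inverse h2.inverse

/-- All occurrences are covered, not just one, because exchanges change the occurrence. -/
theorem HasNoLowerCover.not_isPrimeSet (h : HasNoLowerCover π σ) (v : Fin σ.size)
    (f : Fin π.size → Fin σ.size) (hf : IsOccurrence π σ f) (hv : v ∉ Set.range f) :
    ¬ IsPrimeSet σ.code {v}ᶜ := by
  intro hp
  obtain ⟨τ, g, hg, hr, hτ, hs⟩ := isPrimeSet_exists_pattern hp
  refine h τ hτ hs (hf.isPattern_of_range_subset hg ?_) hg.isPattern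
  rw [hr]
  rintro z hz rfl
  exact hv hz

theorem IsPairDeletion.isZigzag_both (hσ : σ.IsSimple) (h4 : 4 ≤ σ.size) (hπ : π.IsSimple)
    (H : HasNoLowerCover π σ) {a b c : Fin σ.size} (h1 : IsPairDeletion π σ a b)
    (h2 : IsPairDeletion π σ b c) (hmid : IsMid 1 b a c) (hadj : IsAdj σ.2 a c) :
    σ.IsZigzag ∧ π.IsZigzag := by
  obtain ⟨hz, hall⟩ := h1.isZigzag hσ h4 hπ H.not_isPrimeSet h2 hmid hadj
  exact ⟨hz, hz.of_pairDeletion (x := ⟨0, by omega⟩) (y := ⟨1, by omega⟩) rfl rfl (hall _ _ rfl)⟩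

theorem IsPairDeletion.isZigzag_or_inverse (hσ : σ.IsSimple) (h4 : 4 ≤ σ.size) (hπ : π.IsSimple)
    (H : HasNoLowerCover π σ) {x y : Fin σ.size} (h : IsPairDeletion π σ x y) :
    σ.IsZigzag ∧ π.IsZigzag ∨ σ.inverse.IsZigzag ∧ π.inverse.IsZigzag := by
  have key : ∀ x y z : Fin σ.size, z ≠ x → z ≠ y → IsPairDeletion π σ x y →
      IsPairDeletion π σ x z → (∀ w, w ≠ x → w ≠ y → w ≠ z → σ.code w y = σ.code w z) →
      σ.IsZigzag ∧ π.IsZigzag ∨ σ.inverse.IsZigzag ∧ π.inverse.IsZigzag := by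
    intro x y z hzx hzy hy hz htw
    rcases hσ.mid_or_mid h4 hy.1 hzx.symm hzy.symm htw with ⟨hm, ha⟩ | ⟨hm, ha⟩
    · exact Or.inl (hy.symm.isZigzag_both hσ h4 hπ H hz hm ha)
    -- Separation by value in `σ` is separation by position in the inverse.
    · refine Or.inr (hy.symm.inverse.isZigzag_both hσ.inverse h4 hπ.inverse H.inverse hz.inverse
        hm ?_)
      have e : ∀ i, σ.inverse.2 (σ.2 i) = i := σ.2.symm_apply_apply
      simp only [IsAdj, Equiv.Perm.coe_one, id] at ha ⊢
      rw [e, e]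
      exact ha
  rcases h.outer_or_exchange hπ H.not_isPrimeSet with hy | ⟨z, h1, h2, h3, h4⟩
  · rcases h.symm.outer_or_exchange hπ H.not_isPrimeSet with hx | ⟨z, h1, h2, h3, h4⟩
    · rw [Set.pair_comm] at hx
      exact (hσ.not_outer_both h4 hx hy).elim
    · exact key y x z h1 h2 h.symm h3 h4
  · exact key x y z h1 h2 h h3 h4

/-- Deleting an end entry turns its neighbour into a corner; deleting an inner entry turns its two
neighbours into twins. -/
theorem IsZigzag.not_isPrimeSet (hσ : σ.IsZigzag) (h4 : 4 ≤ σ.size) (v : Fin σ.size) :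
    ¬ IsPrimeSet σ.code {v}ᶜ := by
  intro hp
  have h3 : ∀ a b, ∃ w ∈ ({v}ᶜ : Set (Fin σ.size)), w ≠ a ∧ w ≠ b := by
    intro a b
    obtain ⟨w, h1, h2, h3⟩ := exists_ne_three h4 v a b
    exact ⟨w, h1, h2, h3⟩
  have hout : ∀ j, j ≠ v → ¬ IsOuter σ.code {v, j}ᶜ j := by
    intro j hj ho
    refine hp.not_uniform h3 (u := j) hj fun a ha b hb haj hbj => ho a ?_ b ?_
    · simp only [Set.mem_compl_iff, Set.mem_singleton_iff] at ha
      simp [ha, haj]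
    · simp only [Set.mem_compl_iff, Set.mem_singleton_iff] at hb
      simp [hb, hbj]
  by_cases h0 : (v : ℕ) = 0
  · exact hout ⟨1, by omega⟩ (by rw [Ne, Fin.ext_iff]; simp only; omega) (hσ.left _ _ h0 rfl)
  by_cases h1 : (v : ℕ) + 1 = σ.size
  · exact hout ⟨σ.size - 2, by omega⟩ (by rw [Ne, Fin.ext_iff]; simp only; omega)
      (hσ.right _ _ h1 (by simp only; omega))
  have hadj := hσ.adj ⟨v - 1, by omega⟩ ⟨v + 1, by omega⟩ (by simp only; omega)
  refine hp.not_twins h3 (u := ⟨v - 1, by omega⟩) (v := ⟨v + 1, by omega⟩) ?_ ?_ ?_ ?_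
  · rw [Set.mem_compl_iff, Set.mem_singleton_iff, Fin.ext_iff]; simp only; omega
  · rw [Set.mem_compl_iff, Set.mem_singleton_iff, Fin.ext_iff]; simp only; omega
  · rw [Ne, Fin.ext_iff]; simp only; omega
  · intro w hwv hw1 hw2
    have a1 := σ.lt_or_gt_value hw1
    have a2 := σ.lt_or_gt_value hw2
    rw [Set.mem_compl_iff, Set.mem_singleton_iff, Fin.ext_iff] at hwv
    rw [Ne, Fin.ext_iff] at hw1 hw2
    simp only at hw1 hw2
    rw [code_eq_iff]
    simp only [IsAdj] at hadj
    constructor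
    · simp only [Fin.lt_def]; omega
    · omega

/-- A permutation of zigzag shape is critical: it has no simple one-point deletion. -/
theorem IsZigzag.not_isSimple_of_isPattern (hσ : σ.IsZigzag) (h4 : 4 ≤ σ.size)
    (hs : τ.size + 1 = σ.size) (hpat : τ.IsPattern σ) : ¬ τ.IsSimple := by
  intro hτ
  obtain ⟨f, hf⟩ := isPattern_iff.mp hpat
  have h1 := hf.ncard_range
  have h2 := Set.ncard_add_ncard_compl (Set.range f)
  rw [h1, Nat.card_fin] at h2
  obtain ⟨v, hv⟩ := Set.ncard_eq_one.mp (show (Set.range f)ᶜ.ncard = 1 by omega)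
  have hr : Set.range f = {v}ᶜ := by rw [← hv, compl_compl]
  exact hσ.not_isPrimeSet h4 v (hr ▸ hf.isPrimeSet_range_iff.mpr hτ)

/-! ### Zigzag permutations are exceptional, and conversely up to inverses. -/

section Sequence

variable {n : ℕ} {g : ℕ → ℤ}

/-- An injective integer sequence with steps `±1` is an arithmetic progression. -/
theorem eq_add_mul_of_unit_steps {N : ℕ} {s : ℕ → ℤ}
    (hinj : ∀ i j, i ≤ N → j ≤ N → s i = s j → i = j)
    (hstep : ∀ i, i < N → s (i + 1) = s i + 1 ∨ s (i + 1) = s i - 1) :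
    ∀ i, i ≤ N → s i = s 0 + (s 1 - s 0) * i := by
  have key : ∀ i, i < N → s i = s 0 + (s 1 - s 0) * i ∧ s (i + 1) - s i = s 1 - s 0 := by
    intro i
    induction i with
    | zero => intro _; simp
    | succ i ih =>
      intro hi
      obtain ⟨h1, h2⟩ := ih (by omega)
      have h3 : s (i + 1) = s 0 + (s 1 - s 0) * ((i + 1 : ℕ) : ℤ) := by
        push_cast
        linarith
      have h4 := hstep i (by omega)
      have h5 := hstep (i + 1) hi
      have h6 : s (i + 1 + 1) ≠ s i := fun h => by
        have := hinj _ _ (by omega) (by omega) h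
        omega
      exact ⟨h3, by omega⟩
  intro i hi
  rcases Nat.eq_zero_or_pos i with rfl | hpos
  · simp
  · obtain ⟨j, rfl⟩ : ∃ j, i = j + 1 := ⟨i - 1, by omega⟩
    obtain ⟨h1, h2⟩ := key j (by omega)
    push_cast
    linarith

/-- The even and the odd terms are two arithmetic progressions with steps `±1`. The corner
conditions make both increase, and injectivity and the range then fix where they start. -/
theorem zigzag_sequence_of_second_lt (hn : 4 ≤ n)
    (hinj : ∀ i j, i < n → j < n → g i = g j → i = j)
    (hrange : ∀ i, i < n → 0 ≤ g i ∧ g i < n)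
    (hstep : ∀ i, i + 2 < n → g (i + 2) = g i + 1 ∨ g (i + 2) = g i - 1)
    (hleft : ∀ w, 2 ≤ w → w < n → g 1 < g w)
    (hright : (∀ w, w + 2 < n → g (n - 2) < g w) ∨ ∀ w, w + 2 < n → g w < g (n - 2)) :
    ∃ m, n = 2 * m ∧ ∀ i, i < m → g (2 * i) = m + i ∧ g (2 * i + 1) = i := by
  have hodd : ∀ N, 1 ≤ N → 2 * N + 1 < n → ∀ i, i ≤ N → g (2 * i + 1) = g 1 + i := by
    intro N hN hNn i hi
    have h := eq_add_mul_of_unit_steps (N := N) (s := fun i => g (2 * i + 1))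
      (fun i j hi hj h => by have := hinj _ _ (by omega) (by omega) h; omega)
      (fun i hi => hstep (2 * i + 1) (by omega)) i hi
    have h1 := hstep 1 (by omega)
    have h2 := hleft 3 (by omega) (by omega)
    have h3 : g (2 * 1 + 1) - g (2 * 0 + 1) = 1 := by norm_num at h1 ⊢; omega
    rw [h3] at h
    simpa using h
  have heven : ∀ N, 1 ≤ N → 2 * N < n → ∀ i, i ≤ N → g (2 * i) = g 0 + (g 2 - g 0) * i := by
    intro N hN hNn i hi
    exact eq_add_mul_of_unit_steps (N := N) (s := fun i => g (2 * i))
      (fun i j hi hj h => by have := hinj _ _ (by omega) (by omega) h; omega)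
      (fun i hi => hstep (2 * i) (by omega)) i hi
  have hmax : ∀ w, w + 2 < n → g w < g (n - 2) := by
    refine hright.resolve_left fun h => ?_
    have h1 := h 1 (by omega)
    have h2 := hleft (n - 2) (by omega) (by omega)
    omega
  rcases Nat.even_or_odd' n with ⟨m, hm | hm⟩
  · refine ⟨m, hm, ?_⟩
    have h2 : g 2 = g 0 + 1 := by
      rcases hstep 0 (by omega) with h | h
      · exact h
      · exfalso
        have e1 := heven (m - 1) (by omega) (by omega) (m - 1) le_rfl
        have e2 := heven (m - 1) (by omega) (by omega) (m - 2) (by omega)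
        have h3 := hmax (2 * (m - 2)) (by omega)
        have h4 : g 2 - g 0 = -1 := by simp only [zero_add] at h; omega
        have h5 : n - 2 = 2 * (m - 1) := by omega
        rw [h5, e1, e2, h4] at h3
        omega
    have h21 : g 2 - g 0 = 1 := by omega
    have hodd' := hodd (m - 1) (by omega) (by omega)
    have heven' := heven (m - 1) (by omega) (by omega)
    rw [h21] at heven'
    have h3 := hleft 2 le_rfl (by omega)
    -- Otherwise `g 0`, which is at least `g 1`, would be one of the odd-indexed values `g 1, …, g 1
    -- + m - 1`.
    have h4 : g 1 + m ≤ g 0 := by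
      by_contra hlt
      have e := hodd' (g 0 - g 1).toNat (by omega)
      have := hinj _ 0 (by omega) (by omega) (e.trans (by omega))
      omega
    have h5 := hrange 1 (by omega)
    have h6 := hrange (2 * (m - 1)) (by omega)
    have h7 := heven' (m - 1) le_rfl
    intro i hi
    have h8 := heven' i (by omega)
    have h9 := hodd' i (by omega)
    omega
  -- For odd `n` the maximum `g (n - 2)` has odd index, so `g 2` falls among the odd-indexed values,
  -- against injectivity.
  · exfalso
    have hodd' := hodd (m - 1) (by omega) (by omega)
    have h1 := hodd' (m - 1) le_rfl
    have h2 := hmax 2 (by omega)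
    have h3 := hleft 2 le_rfl (by omega)
    have h5 : n - 2 = 2 * (m - 1) + 1 := by omega
    rw [h5] at h2
    have e := hodd' (g 2 - g 1).toNat (by omega)
    have := hinj _ 2 (by omega) (by omega) (e.trans (by omega))
    omega

end Sequence

/-- The values as a sequence of integers. -/
def values (σ : Permutation) (i : ℕ) : ℤ := if h : i < σ.size then (σ.2 ⟨i, h⟩ : ℕ) else 0

theorem values_of_lt {i : ℕ} (h : i < σ.size) : σ.values i = (σ.2 ⟨i, h⟩ : ℕ) := dif_pos h

theorem hasEntry_iff {p v : ℕ} : σ.HasEntry p v ↔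
    1 ≤ p ∧ p ≤ σ.size ∧ σ.values (p - 1) + 1 = v := by
  constructor
  · rintro ⟨k, rfl, rfl⟩
    refine ⟨by omega, k.2, ?_⟩
    rw [values_of_lt (by simp)]
    simp
  · rintro ⟨h1, h2, h3⟩
    rw [values_of_lt (by omega)] at h3
    exact ⟨⟨p - 1, by omega⟩, by simp only; omega, by omega⟩

theorem values_inj {i j : ℕ} (hi : i < σ.size) (hj : j < σ.size) (h : σ.values i = σ.values j) :
    i = j := by
  rw [values_of_lt hi, values_of_lt hj, Nat.cast_inj, ← Fin.ext_iff] at h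
  exact Fin.mk.inj_iff.mp (σ.2.injective h)

theorem extreme_of_isOuter {x y : Fin σ.size} (ho : IsOuter σ.code {x, y}ᶜ y) :
    (∀ w, w ≠ x → w ≠ y → σ.2 y < σ.2 w) ∨ ∀ w, w ≠ x → w ≠ y → σ.2 w < σ.2 y := by
  by_contra hcon
  push Not at hcon
  obtain ⟨⟨a, hax, hay, ha⟩, b, hbx, hby, hb⟩ := hcon
  have := (code_eq_iff.mp (ho a (by simp [hax, hay]) b (by simp [hbx, hby]))).2
  have := σ.lt_or_gt_value hay
  have := σ.lt_or_gt_value hby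
  omega

theorem IsZigzag.type3_or_type4 (h : σ.IsZigzag) (h4 : 4 ≤ σ.size) :
    ∃ m, 2 ≤ m ∧ (IsType3 m σ ∨ IsType4 m σ) := by
  have hstep : ∀ i, i + 2 < σ.size →
      σ.values (i + 2) = σ.values i + 1 ∨ σ.values (i + 2) = σ.values i - 1 := by
    intro i hi
    have := h.adj ⟨i, by omega⟩ ⟨i + 2, hi⟩ rfl
    rw [values_of_lt hi, values_of_lt (by omega)]
    simp only [IsAdj] at this
    omega
  have hrange : ∀ i, i < σ.size → 0 ≤ σ.values i ∧ σ.values i < σ.size := by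
    intro i hi
    rw [values_of_lt hi]
    exact ⟨Int.natCast_nonneg _, Int.ofNat_lt.mpr (σ.2 ⟨i, hi⟩).2⟩
  have hleft : (∀ w, 2 ≤ w → w < σ.size → σ.values 1 < σ.values w) ∨
      ∀ w, 2 ≤ w → w < σ.size → σ.values w < σ.values 1 := by
    refine (extreme_of_isOuter (h.left ⟨0, by omega⟩ ⟨1, by omega⟩ rfl rfl)).imp ?_ ?_ <;>
    · intro h w hw hwn
      have := h ⟨w, hwn⟩ (by rw [Ne, Fin.ext_iff]; simp only; omega)
        (by rw [Ne, Fin.ext_iff]; simp only; omega)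
      rw [values_of_lt hwn, values_of_lt (by omega)]
      exact_mod_cast this
  have hright : (∀ w, w + 2 < σ.size → σ.values (σ.size - 2) < σ.values w) ∨
      ∀ w, w + 2 < σ.size → σ.values w < σ.values (σ.size - 2) := by
    refine (extreme_of_isOuter (h.right ⟨σ.size - 1, by omega⟩ ⟨σ.size - 2, by omega⟩
      (by simp only; omega) (by simp only; omega))).imp ?_ ?_ <;>
    · intro h w hw
      have := h ⟨w, by omega⟩ (by rw [Ne, Fin.ext_iff]; simp only; omega)
        (by rw [Ne, Fin.ext_iff]; simp only; omega)
      rw [values_of_lt (by omega), values_of_lt (by omega)]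
      exact_mod_cast this
  rcases hleft with hleft | hleft
  · obtain ⟨m, hm, hv⟩ := zigzag_sequence_of_second_lt h4 (fun i j => values_inj) hrange hstep
      hleft hright
    refine ⟨m, by omega, Or.inl ⟨hm, fun i h1 h2 => ?_⟩⟩
    obtain ⟨e1, e2⟩ := hv (i - 1) (by omega)
    rw [hasEntry_iff, hasEntry_iff]
    rw [show 2 * i - 1 - 1 = 2 * (i - 1) by omega, show 2 * i - 1 = 2 * (i - 1) + 1 by omega]
    omega
  -- Complementing the values reduces the case of a maximal second entry to that of a minimal one.
  · obtain ⟨m, hm, hv⟩ := zigzag_sequence_of_second_lt (g := fun i => σ.size - 1 - σ.values i) h4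
      (fun i j hi hj hij => values_inj hi hj (by omega))
      (fun i hi => by have := hrange i hi; omega)
      (fun i hi => by have := hstep i hi; omega)
      (fun w h1 h2 => by have := hleft w h1 h2; omega)
      (hright.symm.imp (fun h w hw => by have := h w hw; omega)
        (fun h w hw => by have := h w hw; omega))
    refine ⟨m, by omega, Or.inr ⟨hm, fun i h1 h2 => ?_⟩⟩
    obtain ⟨e1, e2⟩ := hv (i - 1) (by omega)
    rw [hasEntry_iff, hasEntry_iff]
    rw [show 2 * i - 1 - 1 = 2 * (i - 1) by omega, show 2 * i - 1 = 2 * (i - 1) + 1 by omega]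
    omega

theorem isZigzag_of_values
    (hadj : ∀ i, i + 2 < σ.size →
      σ.values (i + 2) = σ.values i + 1 ∨ σ.values (i + 2) = σ.values i - 1)
    (hleft : (∀ w, 2 ≤ w → w < σ.size → σ.values 1 < σ.values w) ∨
      ∀ w, 2 ≤ w → w < σ.size → σ.values w < σ.values 1)
    (hright : (∀ w, w + 2 < σ.size → σ.values (σ.size - 2) < σ.values w) ∨
      ∀ w, w + 2 < σ.size → σ.values w < σ.values (σ.size - 2)) : σ.IsZigzag := by
  have hval : ∀ i : Fin σ.size, σ.values i = (σ.2 i : ℕ) := fun i => values_of_lt i.2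
  refine ⟨fun i j hij => ?_, fun i j hi hj a ha b hb => ?_, fun i j hi hj a ha b hb => ?_⟩
  · have := hadj i (by omega)
    rw [hij, hval, hval] at this
    simp only [IsAdj]
    omega
  all_goals
    simp only [Set.mem_compl_iff, Set.mem_insert_iff, Set.mem_singleton_iff, not_or] at ha hb
    rw [code_eq_iff]
  · have e : σ.values 1 = (σ.2 j : ℕ) := by rw [← hj, hval]
    rw [e] at hleft
    have ea := hval a
    have eb := hval b
    refine ⟨by omega, ?_⟩
    rcases hleft with h | h
    · have := h a (by omega) a.2
      have := h b (by omega) b.2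
      omega
    · have := h a (by omega) a.2
      have := h b (by omega) b.2
      omega
  · have e : σ.values (σ.size - 2) = (σ.2 j : ℕ) := by rw [← hj, Nat.add_sub_cancel, hval]
    rw [e] at hright
    have ea := hval a
    have eb := hval b
    refine ⟨by omega, ?_⟩
    rcases hright with h | h
    · have := h a (by omega)
      have := h b (by omega)
      omega
    · have := h a (by omega)
      have := h b (by omega)
      omega

theorem IsType3.isZigzag {m : ℕ} (hm : 2 ≤ m) (h : IsType3 m σ) : σ.IsZigzag := by
  obtain ⟨hs, h⟩ := h
  have hv : ∀ i, i < m → σ.values (2 * i) = m + i ∧ σ.values (2 * i + 1) = i := by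
    intro i hi
    obtain ⟨h1, h2⟩ := h (i + 1) (by omega) (by omega)
    rw [hasEntry_iff] at h1 h2
    rw [show 2 * (i + 1) - 1 - 1 = 2 * i by omega] at h1
    rw [show 2 * (i + 1) - 1 = 2 * i + 1 by omega] at h2
    omega
  have hcase : ∀ w, w < 2 * m → ∃ i, i < m ∧ (w = 2 * i ∧ σ.values w = m + i ∨
      w = 2 * i + 1 ∧ σ.values w = i) := by
    intro w hw
    obtain ⟨h1, h2⟩ := hv (w / 2) (by omega)
    refine ⟨w / 2, by omega, ?_⟩
    rcases Nat.mod_two_eq_zero_or_one w with h | h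
    · rw [show 2 * (w / 2) = w by omega] at h1
      omega
    · rw [show 2 * (w / 2) + 1 = w by omega] at h2
      omega
  refine isZigzag_of_values (fun i hi => ?_) (Or.inl fun w hw hwn => ?_)
    (Or.inr fun w hw => ?_)
  · have h1 := hcase i (by omega)
    have h2 := hcase (i + 2) (by omega)
    omega
  · have h1 := hcase 1 (by omega)
    have h2 := hcase w (by omega)
    omega
  · have h1 := hcase (σ.size - 2) (by omega)
    have h2 := hcase w (by omega)
    omega

theorem IsType4.isZigzag {m : ℕ} (hm : 2 ≤ m) (h : IsType4 m σ) : σ.IsZigzag := by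
  obtain ⟨hs, h⟩ := h
  have hv : ∀ i, i < m → σ.values (2 * i) = m - 1 - i ∧ σ.values (2 * i + 1) = 2 * m - 1 - i := by
    intro i hi
    obtain ⟨h1, h2⟩ := h (i + 1) (by omega) (by omega)
    rw [hasEntry_iff] at h1 h2
    rw [show 2 * (i + 1) - 1 - 1 = 2 * i by omega] at h1
    rw [show 2 * (i + 1) - 1 = 2 * i + 1 by omega] at h2
    omega
  have hcase : ∀ w, w < 2 * m → ∃ i, i < m ∧ (w = 2 * i ∧ σ.values w = m - 1 - i ∨
      w = 2 * i + 1 ∧ σ.values w = 2 * m - 1 - i) := by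
    intro w hw
    obtain ⟨h1, h2⟩ := hv (w / 2) (by omega)
    refine ⟨w / 2, by omega, ?_⟩
    rcases Nat.mod_two_eq_zero_or_one w with h | h
    · rw [show 2 * (w / 2) = w by omega] at h1
      omega
    · rw [show 2 * (w / 2) + 1 = w by omega] at h2
      omega
  refine isZigzag_of_values (fun i hi => ?_) (Or.inr fun w hw hwn => ?_)
    (Or.inl fun w hw => ?_)
  · have h1 := hcase i (by omega)
    have h2 := hcase (i + 2) (by omega)
    omega
  · have h1 := hcase 1 (by omega)
    have h2 := hcase w (by omega)
    omega
  · have h1 := hcase (σ.size - 2) (by omega)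
    have h2 := hcase w (by omega)
    omega

theorem hasEntry_inverse {p v : ℕ} : σ.inverse.HasEntry v p ↔ σ.HasEntry p v := by
  constructor
  · rintro ⟨k, h1, h2⟩
    exact ⟨σ.2.symm k, h2, (congrArg (fun j : Fin σ.size => (j : ℕ) + 1) (σ.2.apply_symm_apply k)).trans h1⟩
  · rintro ⟨k, h1, h2⟩
    refine ⟨σ.2 k, h2, ?_⟩
    rw [← h1, show σ.inverse.2 (σ.2 k) = k from σ.2.symm_apply_apply k]

theorem isType1_inverse_iff {m : ℕ} : IsType1 m σ.inverse ↔ IsType3 m σ := by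
  simp only [IsType1, IsType3, hasEntry_inverse]
  exact and_congr_right fun _ => forall_congr' fun _ => imp_congr_right fun _ =>
    imp_congr_right fun _ => and_comm

theorem isType2_inverse_iff {m : ℕ} : IsType2 m σ.inverse ↔ IsType4 m σ := by
  simp only [IsType2, IsType4, hasEntry_inverse]
  refine and_congr_right fun _ => ⟨fun h i h1 h2 => ?_, fun h i h1 h2 => ?_⟩
  all_goals
    -- Values decrease along each half of these words, so inversion reverses the index `i`.
    obtain ⟨e1, e2⟩ := h (m + 1 - i) (by omega) (by omega)
  · rw [show 2 * m + 1 - 2 * (m + 1 - i) = 2 * i - 1 by omega] at e1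
    rw [show 2 * m + 2 - 2 * (m + 1 - i) = 2 * i by omega,
      show m + (m + 1 - i) = 2 * m + 1 - i by omega] at e2
    exact ⟨e1, e2⟩
  · rw [show 2 * (m + 1 - i) - 1 = 2 * m + 1 - 2 * i by omega,
      show m + 1 - (m + 1 - i) = i by omega] at e1
    rw [show 2 * (m + 1 - i) = 2 * m + 2 - 2 * i by omega,
      show 2 * m + 1 - (m + 1 - i) = m + i by omega] at e2
    exact ⟨e1, e2⟩

theorem IsZigzag.isExceptional (h : σ.IsZigzag) (h4 : 4 ≤ σ.size) : σ.IsExceptional := by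
  obtain ⟨m, hm, h3 | h4⟩ := h.type3_or_type4 h4
  · exact ⟨m, hm, Or.inr (Or.inr (Or.inl h3))⟩
  · exact ⟨m, hm, Or.inr (Or.inr (Or.inr h4))⟩

theorem IsZigzag.isExceptional_of_inverse (h : σ.inverse.IsZigzag) (h4 : 4 ≤ σ.size) :
    σ.IsExceptional := by
  obtain ⟨m, hm, h3 | h4⟩ := h.type3_or_type4 h4
  · exact ⟨m, hm, Or.inl (isType1_inverse_iff.mpr h3)⟩
  · exact ⟨m, hm, Or.inr (Or.inl (isType2_inverse_iff.mpr h4))⟩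

theorem IsExceptional.isZigzag_or_inverse (h : σ.IsExceptional) :
    4 ≤ σ.size ∧ (σ.IsZigzag ∨ σ.inverse.IsZigzag) := by
  obtain ⟨m, hm, h | h | h | h⟩ := h
  · exact ⟨by have := h.1; omega, Or.inr ((isType1_inverse_iff (σ := σ.inverse)).mp h |>.isZigzag hm)⟩
  · exact ⟨by have := h.1; omega, Or.inr ((isType2_inverse_iff (σ := σ.inverse)).mp h |>.isZigzag hm)⟩
  · exact ⟨by have := h.1; omega, Or.inl (h.isZigzag hm)⟩
  · exact ⟨by have := h.1; omega, Or.inl (h.isZigzag hm)⟩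

theorem IsExceptional.not_isSimple_of_isPattern (h : σ.IsExceptional)
    (hs : τ.size + 1 = σ.size) (hpat : τ.IsPattern σ) : ¬ τ.IsSimple := by
  obtain ⟨h4, hz | hz⟩ := h.isZigzag_or_inverse
  · exact hz.not_isSimple_of_isPattern h4 hs hpat
  · exact fun hτ => hz.not_isSimple_of_isPattern h4 (τ := τ.inverse) hs hpat.inverse hτ.inverse

theorem IsExceptional.even_size (h : σ.IsExceptional) : ∃ m, σ.size = 2 * m := by
  obtain ⟨m, -, h | h | h | h⟩ := h <;> exact ⟨m, h.1⟩

/-! ### One step down, and the chain. -/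

/-- Below a simple permutation and above a proper simple pattern there is a simple permutation
with one entry less, or one with two entries less, both permutations being exceptional. -/
theorem IsSimple.exists_lower (hπ : π.IsSimple) (hσ : σ.IsSimple) (hne : π ≠ σ)
    (hpat : π.IsPattern σ) (h3 : 3 ≤ π.size) :
    ∃ τ : Permutation, τ.IsSimple ∧ π.IsPattern τ ∧ τ.IsPattern σ ∧
      (σ.size = τ.size + 1 ∨ σ.size = τ.size + 2 ∧ σ.IsExceptional ∧ τ.IsExceptional) := by
  by_cases H : HasNoLowerCover π σ
  swap
  · unfold HasNoLowerCover at H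
    push Not at H
    obtain ⟨τ, h1, h2, h3, h4⟩ := H
    exact ⟨τ, h1, h3, h4, Or.inl h2.symm⟩
  obtain ⟨f, hf⟩ := isPattern_iff.mp hpat
  obtain ⟨Y, hXY, hY, ⟨v, rfl⟩ | ⟨x, y, hxy, rfl⟩⟩ := IsPrimeSet.exists_large σ.isReversible_code
    (hf.isPrimeSet_range_iff.mpr hπ) (hf.exists_third h3) ((isSimple_iff σ).mp hσ)
    (fun h => hne (hf.eq_of_surjective (Set.range_eq_univ.mp h)))
  · exact (H.not_isPrimeSet v f hf (fun h => hXY h rfl) hY).elim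
  · obtain ⟨τ, g, hg, hr⟩ := exists_occurrence σ {x, y}ᶜ
    have hτ := hg.isPrimeSet_range_iff.mp (hr ▸ hY)
    have hd : IsPairDeletion τ σ x y := ⟨hxy, g, hg, hr⟩
    have hπτ := hf.isPattern_of_range_subset hg (hr ▸ hXY)
    have hs := hd.size_eq
    have hτ3 : 3 ≤ τ.size := by
      obtain ⟨k, hk⟩ := isPattern_iff.mp hπτ
      have := Fintype.card_le_of_injective k hk.strictMono.injective
      simp only [Fintype.card_fin] at this
      omega
    have h4 : 4 ≤ σ.size := by omega
    have H' : HasNoLowerCover τ σ := fun ρ h1 h2 h3 h4 => by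
      obtain ⟨k, hk⟩ := isPattern_iff.mp hπτ
      obtain ⟨l, hl⟩ := isPattern_iff.mp h3
      exact H ρ h1 h2 (isPattern_iff.mpr ⟨l ∘ k, fun a b => (hl _ _).trans (hk a b)⟩) h4
    refine ⟨τ, hτ, hπτ, hg.isPattern, Or.inr ⟨hs.symm, ?_⟩⟩
    rcases hd.isZigzag_or_inverse hσ h4 hτ H' with ⟨h1, h2⟩ | ⟨h1, h2⟩
    · have he := h1.isExceptional h4
      -- Evenness of `σ.size` raises the bound `3 ≤ τ.size` to the required `4 ≤ τ.size`.
      obtain ⟨m, hm⟩ := he.even_size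
      exact ⟨he, h2.isExceptional (by omega)⟩
    · have he := h1.isExceptional_of_inverse h4
      obtain ⟨m, hm⟩ := he.even_size
      exact ⟨he, h2.isExceptional_of_inverse (by omega)⟩

theorem IsSimple.exists_chain (hπ : π.IsSimple) (hσ : σ.IsSimple)
    (hpat : π.IsPattern σ) (hsize : 3 ≤ π.size) :
    ∃ (k m : ℕ) (c : ℕ → Permutation), m ≤ k ∧ c 0 = σ ∧ c k = π ∧
      (∀ i : ℕ, i ≤ k → (c i).IsSimple) ∧
      (∀ i : ℕ, 1 ≤ i → i ≤ k → (c i).IsPattern (c (i - 1))) ∧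
      (∀ i : ℕ, 1 ≤ i → i ≤ m → (c (i - 1)).size = (c i).size + 1) ∧
      (∀ i : ℕ, m + 1 ≤ i → i ≤ k → (c (i - 1)).size = (c i).size + 2) ∧
      (m < k → ∀ i : ℕ, m ≤ i → i ≤ k → (c i).IsExceptional) := by
  induction hn : σ.size using Nat.strong_induction_on generalizing σ with
  | _ n ih =>
  by_cases hne : π = σ
  · subst hne
    exact ⟨0, 0, fun _ => π, le_rfl, rfl, rfl, fun _ _ => hπ, fun i _ _ => by omega,
      fun i _ _ => by omega, fun i _ _ => by omega, fun h => by omega⟩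
  obtain ⟨τ, hτ, hπτ, hτσ, hcase⟩ := hπ.exists_lower hσ hne hpat hsize
  obtain ⟨k, m, c, hmk, hc0, hck, hs, hp, h1, h2, he⟩ :=
    ih τ.size (by omega) hτ hπτ rfl
  let d : ℕ → Permutation := fun i => Nat.casesOn i σ c
  have hds : ∀ i, i ≤ k + 1 → (d i).IsSimple := by
    rintro (_ | i) hi
    · exact hσ
    · exact hs i (by omega)
  have hdp : ∀ i, 1 ≤ i → i ≤ k + 1 → (d i).IsPattern (d (i - 1)) := by
    rintro (_ | _ | i) hi hik
    · omega
    · change (c 0).IsPattern σ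
      rw [hc0]; exact hτσ
    · exact hp (i + 1) (by omega) (by omega)
  rcases hcase with hcase | ⟨hcase, hσe, hτe⟩
  · refine ⟨k + 1, m + 1, d, by omega, rfl, hck, hds, hdp, ?_, ?_, ?_⟩
    · rintro (_ | _ | i) hi him
      · omega
      · change σ.size = (c 0).size + 1
        rw [hc0, hcase]
      · exact h1 (i + 1) (by omega) (by omega)
    · rintro (_ | _ | i) hi hik
      · omega
      · omega
      · exact h2 (i + 1) (by omega) (by omega)
    · rintro hlt (_ | i) hi hik
      · omega
      · exact he (by omega) i (by omega) (by omega)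
  -- The exceptional `τ` has no simple one-point deletion, so its chain cannot begin with a step of
  -- size one.
  · have hm0 : m = 0 := by
      by_contra hm
      have e1 := h1 1 le_rfl (by omega)
      have e2 := hp 1 le_rfl (by omega)
      rw [Nat.sub_self, hc0] at e1 e2
      exact hτe.not_isSimple_of_isPattern e1.symm e2 (hs 1 (by omega))
    subst hm0
    refine ⟨k + 1, 0, d, by omega, rfl, hck, hds, hdp, fun i _ _ => by omega, ?_, ?_⟩
    · rintro (_ | _ | i) hi hik
      · omega
      · change σ.size = (c 0).size + 2
        rw [hc0, hcase]
      · exact h2 (i + 1) (by omega) (by omega)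
    · rintro - (_ | _ | i) - hik
      · exact hσe
      · change (c 0).IsExceptional
        rw [hc0]; exact hτe
      · exact he (by omega) (i + 1) (by omega) (by omega)

end Permutation

theorem mainTheorem4 (π σ : Permutation) (hπ : π.IsSimple) (hσ : σ.IsSimple) (hne : π ≠ σ)
    (hpat : π.IsPattern σ) (hsize : 3 ≤ π.size) :
    ∃ (k m : ℕ) (c : ℕ → Permutation), m ≤ k ∧ c 0 = σ ∧ c k = π ∧
      (∀ i : ℕ, i ≤ k → (c i).IsSimple) ∧
      (∀ i : ℕ, 1 ≤ i → i ≤ k → (c i).IsPattern (c (i - 1))) ∧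
      (∀ i : ℕ, 1 ≤ i → i ≤ m → (c (i - 1)).size = (c i).size + 1) ∧
      (∀ i : ℕ, m + 1 ≤ i → i ≤ k → (c (i - 1)).size = (c i).size + 2) ∧
      (m < k → ∀ i : ℕ, m ≤ i → i ≤ k → (c i).IsExceptional) :=
  hπ.exists_chain hσ hpat hsize
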